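/- For an integer $N \ge 1$ let $\mathcal C_N$ be the set of all genus-$2$ curves \[ C : y^2 = F(x,z) = f_6 x^6 + f_5 x^5 z + \dots + f_1 x z^5 + f_0 z^6 \] with $f_j \in \mathbb Z$, $|f_j| \le N$, i.e. of all coefficient vectors $(f_0,\dots,f_6)$ for which this curve in the weighted projective plane (weights $1,3,1$ for $x,y,z$) is smooth. For coprime integers $a,b$ put $H(a:b) = \max\{|a|,|b|\}$; the $x$-height of a rational point $(x:y:z)$ on $C$ is the height of its $x$-coordinate $(x:z) \in \mathbb P^1(\mathbb Q)$. Let $\mathbb E_{\le H}(N)$ be the average, over $C \in \mathcal C_N$, of the number of rational points on $C$ of $x$-height at most $H$. Let $\phi(0) = 1$ and, for $t > 0$, \[ \phi(t) = \frac{1}{3\cdot 5\cdot 7\cdot 9\cdot 11\cdot 13\; t^{21}} \sum_{\varepsilon_0,\dots,\varepsilon_6 \in \{\pm 1\}} \varepsilon_0 \varepsilon_1\cdots\varepsilon_6\, \max\{\varepsilon_0 + \varepsilon_1 t + \dots + \varepsilon_6 t^6,\, 0\}^{13/2}. \] For coprime integers $a,b$ let $m_0 = \min\{|a|,|b|\}$,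 $m_1 = \max\{|a|,|b|\}$ and \[ \gamma(a:b) = \frac{1}{m_1^3}\,\phi\Bigl(\frac{m_0}{m_1}\Bigr), \qquad \gamma_H = \sum_{(a:b) \in \mathbb P^1(\mathbb Q),\ H(a:b) \le H} \gamma(a:b). \] Then the following hold. 1. There is an absolute constant $c$ such that for all integers $N \ge 1$ and all real $H \ge 1$ \[ \Bigl| \mathbb E_{\le H}(N) - \frac{\gamma_H}{\sqrt N} \Bigr| \le c\,\bigl( N^{-1} + (\log H) N^{-3/2} + H^5 N^{-13/2} \bigr), \] that is, $\mathbb E_{\le H}(N) = \gamma_H/\sqrt N + O(N^{-1}) + O((\log H) N^{-3/2}) + O(H^5 N^{-13/2})$ uniformly in $N$ and $H$. 2. If $\varepsilon > 0$ and $H(N)$ is a function of $N$ with $H(N) \ll N^{6/5-\varepsilon}$, then $\sqrt N\,\mathbb E_{\le H(N)}(N) - \gamma_{H(N)} \to 0$ as $N \to \infty$. 3. If $\varepsilon > 0$ and $H(N) \ll N^{13/10-\varepsilon}$, then $\mathbb E_{\le H(N)}(N) \to 0$ as $N \to \infty$. -/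

import Mathlib

open Filter Topology Asymptotics

noncomputable section

namespace GenusTwo

/-- The polynomial `y² - (f₆ x⁶ + f₅ x⁵ z + ⋯ + f₀ z⁶)` in the variables `x = X 0`, `y = X 1`,
`z = X 2`; it is the equation of the curve with coefficient vector `f` in the weighted
projective plane in which `x, z` have weight `1` and `y` has weight `3`. -/
def equation (f : Fin 7 → ℤ) : MvPolynomial (Fin 3) ℤ :=
  MvPolynomial.X 1 ^ 2 - ∑ j : Fin 7,
    MvPolynomial.C (f j) * MvPolynomial.X 0 ^ (j : ℕ) * MvPolynomial.X 2 ^ (6 - (j : ℕ))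

/-- The curve `y² = F(x,z)` is smooth (equivalently, it is a curve of genus `2`): over an
algebraic closure of `ℚ` the partial derivatives of its equation have no common zero on it.
The only singular point `(0 : 1 : 0)` of the weighted projective plane is never on the curve,
so this is the usual Jacobian criterion. -/
def IsSmooth (f : Fin 7 → ℤ) : Prop :=
  ∀ v : Fin 3 → AlgebraicClosure ℚ, v ≠ 0 → MvPolynomial.aeval v (equation f) = 0 →
    ∃ i : Fin 3, MvPolynomial.aeval v (MvPolynomial.pderiv i (equation f)) ≠ 0

open Classical in
/-- The set of genus `2` curves `y² = f₆ x⁶ + ⋯ + f₀ z⁶` with integral coefficients `|f_j| ≤ N`. -/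
def curves (N : ℕ) : Finset (Fin 7 → ℤ) :=
  (Fintype.piFinset fun _ : Fin 7 => Finset.Icc (-(N : ℤ)) (N : ℤ)).filter IsSmooth

/-- Two nonzero vectors `(x, y, z)` define the same rational point of the weighted projective
plane iff they differ by the action `c • (x, y, z) = (c x, c³ y, c z)` of some `c ∈ ℚ^×`. -/
def weightedSetoid : Setoid {v : Fin 3 → ℚ // v ≠ 0} where
  r v w := ∃ c : ℚ, c ≠ 0 ∧ w.1 0 = c * v.1 0 ∧ w.1 1 = c ^ 3 * v.1 1 ∧ w.1 2 = c * v.1 2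
  iseqv :=
    { refl := fun v => ⟨1, one_ne_zero, by simp, by simp, by simp⟩
      symm := by
        rintro v w ⟨c, hc, h0, h1, h2⟩
        refine ⟨c⁻¹, inv_ne_zero hc, ?_, ?_, ?_⟩
        · rw [h0]; field_simp
        · rw [h1]; field_simp
        · rw [h2]; field_simp
      trans := by
        rintro u v w ⟨c, hc, h0, h1, h2⟩ ⟨d, hd, k0, k1, k2⟩
        refine ⟨d * c, mul_ne_zero hd hc, ?_, ?_, ?_⟩
        · rw [k0, h0]; ring
        · rw [k1, h1]; ring
        · rw [k2, h2]; ring }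

/-- The rational points of the weighted projective plane with weights `1, 3, 1`. -/
def WeightedPlane : Type := Quotient weightedSetoid

/-- The `x`-coordinate `(x : z) ∈ ℙ¹(ℚ) = ℚ ∪ {∞}` of the point `(x : y : z)`, where `(a : b)` is
`a / b` for `b ≠ 0` and `∞` for `b = 0`. It is only used for points that are not `(0 : 1 : 0)`. -/
def xCoord : WeightedPlane → OnePoint ℚ :=
  Quotient.lift
    (fun v : {v : Fin 3 → ℚ // v ≠ 0} =>
      if v.1 2 = 0 then OnePoint.infty else OnePoint.some (v.1 0 / v.1 2)) (by
    rintro v w ⟨c, hc, h0, -, h2⟩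
    simp only [h0, h2, mul_eq_zero, hc, false_or, mul_div_mul_left _ _ hc])

/-- The point `P` lies on the curve; the condition does not depend on the representative. -/
def OnCurve (f : Fin 7 → ℤ) (P : WeightedPlane) : Prop :=
  ∃ v : {v : Fin 3 → ℚ // v ≠ 0}, Quotient.mk weightedSetoid v = P ∧
    MvPolynomial.aeval v.1 (equation f) = 0

/-- Coprime integers `(a, b)` with `P = (a : b)`, unique up to a common sign. -/
def coprimeRep (P : OnePoint ℚ) : ℤ × ℤ :=
  P.elim (1, 0) fun q : ℚ => (q.num, (q.den : ℤ))

/-- The height `H(a : b) = max {|a|, |b|}` for coprime integers `a, b`. -/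
def height (P : OnePoint ℚ) : ℤ :=
  max |(coprimeRep P).1| |(coprimeRep P).2|

/-- The average number `𝔼_{≤ H}(N)` of rational points whose `x`-coordinate has height at most `H`
on the genus `2` curves with coefficients bounded by `N`. -/
def averagePoints (N : ℕ) (H : ℝ) : ℝ :=
  (∑ f ∈ curves N, (Set.ncard {P : WeightedPlane | OnCurve f P ∧ (height (xCoord P) : ℝ) ≤ H} : ℝ))
    / ((curves N).card : ℝ)

/-- The function `φ`, with `φ 0 = 1` and `φ t = φ |t|`;
note that `3 * 5 * 7 * 9 * 11 * 13 = 135135`. -/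
def phi (t : ℝ) : ℝ :=
  if t = 0 then 1 else
    1 / (3 * 5 * 7 * 9 * 11 * 13 * |t| ^ 21) *
      ∑ ε : Fin 7 → ℤˣ, (∏ i, ((ε i : ℤ) : ℝ)) *
        (max (∑ i : Fin 7, ((ε i : ℤ) : ℝ) * |t| ^ (i : ℕ)) 0) ^ (13 / 2 : ℝ)

/-- `γ(a : b) = m₁⁻³ φ(m₀ / m₁)` with `m₀ = min {|a|, |b|}` and `m₁ = max {|a|, |b|}`, where `a, b` are
coprime integers. -/
def gamma (P : OnePoint ℚ) : ℝ :=
  1 / (height P : ℝ) ^ 3 *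
    phi (((min |(coprimeRep P).1| |(coprimeRep P).2| : ℤ) : ℝ) / (height P : ℝ))

/-- `γ_H`, the (finite) sum of `γ(a : b)` over all `(a : b) ∈ ℙ¹(ℚ)` of height at most `H`. -/
def gammaSum (H : ℝ) : ℝ :=
  ∑ᶠ P ∈ {P : OnePoint ℚ | (height P : ℝ) ≤ H}, gamma P

end GenusTwo

end

/-! Interchange the sums: `𝔼` times the number of curves counts triples `(f, (a : b), y)` with `F(a,
b) = y²`, `y ∈ ℤ`, since each rational point over `(a : b)` is `(a : y : b)` for exactly one integer
`y`. Reversing the coefficients allows `|a| ≤ |b| = h`.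

For fixed `m`, the vectors in the box with `F(a, b) = m` are lattice points on a hyperplane section.
Because `F(a, b) = f_k a^k + b G(a, b)`, the top coefficient runs through one residue class modulo
`b` and the rest solve the same problem in lower degree. The limiting densities (`slice`) are even
and unimodal, so a sum over a residue class differs from its integral by at most the maximum.
Induction gives an error `O((1 + N/h)^5)` (`abs_card_solutions_sub_slice_le`). Singular forms cost
no more: eliminating `f_0` and `f_1` shows that the higher coefficients and the value leave at most
six of them with `f_6 ≠ 0` (`card_singular_le`).

Summing over the `O(√N h³)` possible `y`, and replacing the sum of the densities at `y²` by an
integral, gives the main term. Integration in `y` produces truncated square roots, and each further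
coefficient raises the exponent by one and takes a difference; the outcome is `128 N^{13/2} γ(a :
b)` (`integral_slice_eq_phi`). The error is `O(N^6/h³ + √N N^5/h² + √N h³)`.

There are at most `12h` points of height `h`, so the total error is `O(N^6 + √N N^5 log H + √N
H^5)`. Division by the number of curves, `128 N^7 + O(N^6)`, gives the first claim; the other two
follow by inserting the growth of `H` and using that `γ_H` is bounded. -/

namespace GenusTwo

/-! ### Sums of unimodal functions over the integers -/

open MeasureTheory Set

/-- The number of integers in a bounded convex set of reals differs from its length by at most
one. -/
lemma count_int_convex {S : Set ℝ} (hS : Convex ℝ S) (hb : Bornology.IsBounded S) :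
    Measure.count ((Int.cast : ℤ → ℝ) ⁻¹' S) ≤ volume S + 1 ∧
      volume S ≤ Measure.count ((Int.cast : ℤ → ℝ) ⁻¹' S) + 1 := by
  rcases S.eq_empty_or_nonempty with rfl | hne
  · simp
  have hbb := hb.bddBelow
  have hba := hb.bddAbove
  set A := sInf S
  set B := sSup S
  have hAB : A ≤ B := Real.sInf_le_sSup S hbb hba
  have hup : S ⊆ Icc A B := fun x hx => ⟨csInf_le hbb hx, le_csSup hba hx⟩
  -- The endpoints may or may not belong to `S`, so the count is squeezed between those of the open
  -- and the closed interval.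
  have hlow : Ioo A B ⊆ S := by
    rintro x ⟨hx1, hx2⟩
    obtain ⟨u, hu, hu'⟩ := exists_lt_of_csInf_lt hne hx1
    obtain ⟨v, hv, hv'⟩ := exists_lt_of_lt_csSup hne hx2
    exact hS.ordConnected.out hu hv ⟨hu'.le, hv'.le⟩
  have hvol : volume S = ENNReal.ofReal (B - A) := by
    apply le_antisymm
    · simpa using measure_mono (μ := volume) hup
    · simpa using measure_mono (μ := volume) hlow
  have h1 : Measure.count ((Int.cast : ℤ → ℝ) ⁻¹' S) ≤ ((Finset.Icc ⌈A⌉ ⌊B⌋).card : ENNReal) := by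
    rw [← Measure.count_apply_finset, Finset.coe_Icc, ← Int.preimage_Icc]
    exact measure_mono (preimage_mono hup)
  have h2 : ((Finset.Ioo ⌊A⌋ ⌈B⌉).card : ENNReal) ≤ Measure.count ((Int.cast : ℤ → ℝ) ⁻¹' S) := by
    rw [← Measure.count_apply_finset, Finset.coe_Ioo, ← Int.preimage_Ioo]
    exact measure_mono (preimage_mono hlow)
  have e1 : ((Finset.Icc ⌈A⌉ ⌊B⌋).card : ℝ) ≤ B - A + 1 := by
    rw [Int.card_Icc]
    have : ((⌊B⌋ + 1 - ⌈A⌉).toNat : ℝ) = max ((⌊B⌋ + 1 - ⌈A⌉ : ℤ) : ℝ) 0 := by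
      have := Int.toNat_eq_max (⌊B⌋ + 1 - ⌈A⌉)
      exact_mod_cast congrArg (Int.cast : ℤ → ℝ) this
    rw [this]
    apply max_le
    · push_cast
      linarith [Int.floor_le B, Int.le_ceil A]
    · linarith
  have e2 : B - A ≤ ((Finset.Ioo ⌊A⌋ ⌈B⌉).card : ℝ) + 1 := by
    rw [Int.card_Ioo]
    have : ((⌈B⌉ - ⌊A⌋ - 1 : ℤ) : ℝ) ≤ ((⌈B⌉ - ⌊A⌋ - 1).toNat : ℝ) := by
      exact_mod_cast Int.self_le_toNat _
    push_cast at this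
    linarith [Int.floor_le A, Int.le_ceil B]
  constructor
  · refine h1.trans ?_
    rw [hvol, ← ENNReal.ofReal_natCast, ← ENNReal.ofReal_one,
      ← ENNReal.ofReal_add (by linarith) zero_le_one]
    exact ENNReal.ofReal_le_ofReal e1
  · refine le_trans ?_ (add_le_add_left h2 1)
    rw [hvol, ← ENNReal.ofReal_natCast, ← ENNReal.ofReal_one,
      ← ENNReal.ofReal_add (by positivity) zero_le_one]
    exact ENNReal.ofReal_le_ofReal e2

lemma measurable_of_convex_superlevel {ψ : ℝ → ℝ} (h0 : ∀ x, 0 ≤ ψ x)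
    (hconv : ∀ t, 0 ≤ t → Convex ℝ {x | t < ψ x}) : Measurable ψ := by
  refine measurable_of_Ioi fun t => ?_
  rcases lt_or_ge t 0 with ht | ht
  · have : ψ ⁻¹' Ioi t = univ := by
      ext x; simpa using ht.trans_le (h0 x)
    rw [this]; exact MeasurableSet.univ
  · exact (hconv t ht).ordConnected.measurableSet

/-- For a bounded unimodal function with bounded support the sum over the integers differs from the
integral by at most the maximum. -/
lemma abs_sum_sub_integral_le {ψ : ℝ → ℝ} {M R : ℝ} (h0 : ∀ x, 0 ≤ ψ x) (hM : ∀ x, ψ x ≤ M)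
    (hconv : ∀ t, 0 ≤ t → Convex ℝ {x | t < ψ x}) (hsupp : ∀ x, R < |x| → ψ x = 0)
    (s : Finset ℤ) (hs : ∀ n ∉ s, ψ n = 0) :
    |∑ n ∈ s, ψ n - ∫ x, ψ x| ≤ M := by
  have hm := measurable_of_convex_superlevel h0 hconv
  have hM0 : 0 ≤ M := (h0 0).trans (hM 0)
  have hbdd : ∀ t, 0 ≤ t → Bornology.IsBounded {x | t < ψ x} := by
    intro t ht
    refine (Metric.isBounded_Icc (-R) R).subset fun x hx => ?_
    by_contra hcon
    have : R < |x| := by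
      by_contra h
      exact hcon (abs_le.mp (not_lt.mp h))
    have h := hsupp x this
    simp only [mem_ofPred_eq] at hx
    linarith
  -- Layer cake: sum and integral are both integrals over `t > 0` of the size of a convex superlevel
  -- set. The sizes differ by at most one, and both vanish for `t ≥ M`, so the total discrepancy is
  -- at most `M`.
  have hI : ENNReal.ofReal (∫ x, ψ x) = ∫⁻ t in Ioi (0 : ℝ), volume {x | t < ψ x} := by
    rw [← lintegral_eq_lintegral_meas_lt volume (Eventually.of_forall h0) hm.aemeasurable]
    refine ofReal_integral_eq_lintegral_ofReal ?_ (Eventually.of_forall h0)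
    have hint : IntegrableOn ψ (Icc (-R) R) := by
      refine Measure.integrableOn_of_bounded (M := M) (by simp) hm.aestronglyMeasurable
        (Eventually.of_forall fun x => ?_)
      rw [Real.norm_of_nonneg (h0 x)]
      exact hM x
    refine (integrableOn_iff_integrable_of_support_subset ?_).mp hint
    intro x hx
    by_contra hcon
    refine hx (hsupp x ?_)
    by_contra h
    exact hcon (abs_le.mp (not_lt.mp h))
  have hS : ENNReal.ofReal (∑ n ∈ s, ψ n) =
      ∫⁻ t in Ioi (0 : ℝ), Measure.count {n : ℤ | t < ψ n} := by
    rw [← lintegral_eq_lintegral_meas_lt Measure.count (f := fun n : ℤ => ψ n)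
      (Eventually.of_forall fun n => h0 n) (measurable_of_countable _).aemeasurable,
      lintegral_count, ENNReal.ofReal_sum_of_nonneg (s := s) (f := fun n : ℤ => ψ n) fun n _ => h0 n, tsum_eq_sum]
    intro n hn
    rw [hs n hn, ENNReal.ofReal_zero]
  have hMint : ∫⁻ t in Ioi (0 : ℝ), (Iio M).indicator (fun _ => (1 : ENNReal)) t =
      ENNReal.ofReal M := by
    rw [lintegral_indicator_const measurableSet_Iio, one_mul, Measure.restrict_apply measurableSet_Iio,
      inter_comm, Ioi_inter_Iio, Real.volume_Ioo, sub_zero]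
  have key : ∀ t ∈ Ioi (0 : ℝ),
      Measure.count {n : ℤ | t < ψ n} ≤
        volume {x | t < ψ x} + (Iio M).indicator (fun _ => (1 : ENNReal)) t ∧
      volume {x | t < ψ x} ≤
        Measure.count {n : ℤ | t < ψ n} + (Iio M).indicator (fun _ => (1 : ENNReal)) t := by
    intro t ht
    have ht' : 0 ≤ t := le_of_lt ht
    by_cases htM : t < M
    · rw [indicator_of_mem (by exact htM)]
      exact count_int_convex (hconv t ht') (hbdd t ht')
    · have h1 : {x | t < ψ x} = ∅ := by
        ext x; simpa using (hM x).trans (not_lt.mp htM)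
      have h2 : {n : ℤ | t < ψ n} = ∅ := by
        ext x; simpa using (hM x).trans (not_lt.mp htM)
      rw [h1, h2]; simp
  have hi : Measurable ((Iio M).indicator (fun _ => (1 : ENNReal))) :=
    measurable_const.indicator measurableSet_Iio
  have hIpos : 0 ≤ ∫ x, ψ x := integral_nonneg h0
  have hSpos : 0 ≤ ∑ n ∈ s, ψ n := Finset.sum_nonneg fun n _ => h0 n
  have k1 : ENNReal.ofReal (∑ n ∈ s, ψ n) ≤ ENNReal.ofReal (∫ x, ψ x) + ENNReal.ofReal M := by
    rw [hS, hI, ← hMint, ← lintegral_add_right _ hi]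
    exact setLIntegral_mono' measurableSet_Ioi fun t ht => (key t ht).1
  have k2 : ENNReal.ofReal (∫ x, ψ x) ≤ ENNReal.ofReal (∑ n ∈ s, ψ n) + ENNReal.ofReal M := by
    rw [hS, hI, ← hMint, ← lintegral_add_right _ hi]
    exact setLIntegral_mono' measurableSet_Ioi fun t ht => (key t ht).2
  rw [← ENNReal.ofReal_add hIpos hM0, ENNReal.ofReal_le_ofReal_iff (by positivity)] at k1
  rw [← ENNReal.ofReal_add hSpos hM0, ENNReal.ofReal_le_ofReal_iff (by positivity)] at k2
  rw [abs_le]; constructor <;> linarith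

end GenusTwo

/-! ### Even unimodal functions, section densities of a cube, residue classes -/

namespace GenusTwo

open MeasureTheory Set

/-- `g` is an even function that is antitone on the nonnegative reals. -/
def EvenUnimodal (g : ℝ → ℝ) : Prop := ∀ x y, |x| ≤ |y| → g y ≤ g x

namespace EvenUnimodal

variable {g : ℝ → ℝ}

lemma apply_eq (hg : EvenUnimodal g) {x y : ℝ} (h : |x| = |y|) : g x = g y :=
  le_antisymm (hg _ _ h.ge) (hg _ _ h.le)

lemma convex (hg : EvenUnimodal g) (t : ℝ) : Convex ℝ {x | t < g x} := by
  rw [convex_iff_ordConnected]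
  refine ordConnected_of_Ioo fun x hx y hy _ z hz => ?_
  rcases le_total |x| |y| with h | h
  · exact lt_of_lt_of_le hy (hg _ _ (abs_le.mpr ⟨by
      linarith [neg_abs_le x, hz.1], by linarith [le_abs_self y, hz.2]⟩))
  · exact lt_of_lt_of_le hx (hg _ _ (abs_le.mpr ⟨by
      linarith [neg_abs_le x, hz.1], by linarith [le_abs_self y, hz.2]⟩))

lemma measurable (hg : EvenUnimodal g) : Measurable g :=
  measurable_of_Ioi fun t => (hg.convex t).ordConnected.measurableSet

lemma intervalIntegrable (hg : EvenUnimodal g) (h0 : ∀ x, 0 ≤ g x) (a b : ℝ) :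
    IntervalIntegrable g volume a b := by
  rw [intervalIntegrable_iff]
  refine Measure.integrableOn_of_bounded (M := g 0) (by simp)
    hg.measurable.aestronglyMeasurable (Eventually.of_forall fun x => ?_)
  rw [Real.norm_of_nonneg (h0 x)]
  exact hg _ _ (by simp)

/-- Moving the centre from `x` to `y ≥ x ≥ 0` gains the integral of `g (τ + w)` and loses that of `g
(τ - w)` over `τ ∈ [x, y]`; since `|τ - w| ≤ τ + w`, the loss is at least the gain. -/
lemma window (hg : EvenUnimodal g) (h0 : ∀ x, 0 ≤ g x) {w : ℝ} (hw : 0 ≤ w) :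
    EvenUnimodal fun u => ∫ x in (u - w)..(u + w), g x := by
  have even : ∀ u, ∫ x in (-u - w)..(-u + w), g x = ∫ x in (u - w)..(u + w), g x := by
    intro u
    have h := intervalIntegral.integral_comp_neg (a := u - w) (b := u + w) g
    rw [show -(u + w) = -u - w by ring, show -(u - w) = -u + w by ring] at h
    rw [← h]
    exact intervalIntegral.integral_congr fun x _ => hg.apply_eq (by simp)
  have habs : ∀ u, ∫ x in (|u| - w)..(|u| + w), g x = ∫ x in (u - w)..(u + w), g x := by
    intro u
    rcases abs_choice u with h | h <;> rw [h]
    exact even u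
  intro x y hxy
  simp only
  rw [← habs x, ← habs y]
  have hx := abs_nonneg x
  generalize |x| = x at *
  generalize |y| = y at *
  have hi := hg.intervalIntegrable h0
  have h1 : (∫ τ in (y - w)..(y + w), g τ) - ∫ τ in (x - w)..(x + w), g τ =
      (∫ τ in x..y, g (τ + w)) - ∫ τ in x..y, g (τ - w) := by
    rw [intervalIntegral.integral_comp_add_right, intervalIntegral.integral_comp_sub_right]
    have e1 := intervalIntegral.integral_add_adjacent_intervals (hi (x - w) (y - w))
      (hi (y - w) (y + w))
    have e2 := intervalIntegral.integral_add_adjacent_intervals (hi (x - w) (x + w))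
      (hi (x + w) (y + w))
    linarith
  have h2 : (∫ τ in x..y, g (τ + w)) ≤ ∫ τ in x..y, g (τ - w) := by
    refine intervalIntegral.integral_mono_on hxy ?_ ?_ fun τ hτ => hg _ _ ?_
    · simpa using (hi (x + w) (y + w)).comp_add_right w
    · simpa using (hi (x - w) (y - w)).comp_sub_right w
    · rw [abs_of_nonneg (by linarith [hτ.1] : 0 ≤ τ + w)]
      exact abs_le.mpr ⟨by linarith [hτ.1], by linarith⟩
  linarith

/-- A linear substitution turns this into a window of half-width `α N / β`; for `α = 0` the
substitution degenerates and the integrand is constant in `f`. -/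
lemma average (hg : EvenUnimodal g) (h0 : ∀ x, 0 ≤ g x) {N α β : ℝ} (hN : 0 ≤ N) (hα : 0 ≤ α)
    (hβ : 0 < β) : EvenUnimodal fun s => ∫ f in (-N)..N, g ((s - f * α) / β) := by
  rcases hα.eq_or_lt with rfl | hα
  · intro x y hxy
    simp only [mul_zero, sub_zero, intervalIntegral.integral_const, smul_eq_mul]
    refine mul_le_mul_of_nonneg_left (hg _ _ ?_) (by linarith)
    rw [abs_div, abs_div]
    gcongr
  · have key : ∀ s, ∫ f in (-N)..N, g ((s - f * α) / β) =
        (α / β)⁻¹ * ∫ x in (s / β - α / β * N)..(s / β + α / β * N), g x := by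
      intro s
      have h := intervalIntegral.integral_comp_sub_mul (a := -N) (b := N) g
        (c := α / β) (by positivity) (s / β)
      rw [smul_eq_mul, mul_neg, sub_neg_eq_add] at h
      rw [← h]
      congr 1; ext f; congr 1; field_simp
    intro x y hxy
    simp only [key]
    refine mul_le_mul_of_nonneg_left ?_ (by positivity)
    refine hg.window h0 (w := α / β * N) (by positivity) (x / β) (y / β) ?_
    rw [abs_div, abs_div]
    gcongr

end EvenUnimodal

/-- The density at `s` of the push-forward of Lebesgue measure on the cube `[-N, N] ^ (k + 1)` under
`f ↦ ∑ i ≤ k, f i * α ^ i * β ^ (k - i)`. -/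
noncomputable def slice (N α β : ℝ) : ℕ → ℝ → ℝ
  | 0, s => if |s| ≤ N then 1 else 0
  | k + 1, s => β⁻¹ * ∫ f in (-N)..N, slice N α β k ((s - f * α ^ (k + 1)) / β)

section slice

variable {N α β : ℝ} (hN : 0 ≤ N) (hα : 0 ≤ α) (hβ : 0 < β)
include hN hα hβ

lemma slice_aux (k : ℕ) : EvenUnimodal (slice N α β k) ∧ ∀ s, 0 ≤ slice N α β k s := by
  induction k with
  | zero =>
    constructor
    · intro x y hxy
      simp only [slice]
      split_ifs with h1 h2
      · exact le_rfl
      · exact absurd (hxy.trans h1) h2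
      · exact zero_le_one
      · exact le_rfl
    · intro s
      simp only [slice]
      split_ifs <;> norm_num
  | succ k ih =>
    constructor
    · intro x y hxy
      simp only [slice]
      exact mul_le_mul_of_nonneg_left
        (ih.1.average ih.2 hN (pow_nonneg hα (k + 1)) hβ x y hxy) (by positivity)
    · intro s
      simp only [slice]
      exact mul_nonneg (by positivity)
        (intervalIntegral.integral_nonneg (by linarith) fun _ _ => ih.2 _)

lemma slice_evenUnimodal (k : ℕ) : EvenUnimodal (slice N α β k) := (slice_aux hN hα hβ k).1

lemma slice_nonneg (k : ℕ) (s : ℝ) : 0 ≤ slice N α β k s := (slice_aux hN hα hβ k).2 s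

lemma slice_le (k : ℕ) (s : ℝ) : slice N α β k s ≤ (2 * N / β) ^ k := by
  induction k generalizing s with
  | zero =>
    simp only [slice]
    split_ifs <;> norm_num
  | succ k ih =>
    simp only [slice]
    have h : ∫ f in (-N)..N, slice N α β k ((s - f * α ^ (k + 1)) / β) ≤
        (2 * N / β) ^ k * (2 * N) := by
      have h1 := intervalIntegral.norm_integral_le_of_norm_le_const (a := -N) (b := N)
        (C := (2 * N / β) ^ k) (f := fun f => slice N α β k ((s - f * α ^ (k + 1)) / β))
        fun f _ => by
          rw [Real.norm_of_nonneg (slice_nonneg hN hα hβ k _)]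
          exact ih _
      rw [sub_neg_eq_add, ← two_mul, abs_of_nonneg (by positivity)] at h1
      exact (le_abs_self _).trans h1
    calc _ ≤ β⁻¹ * ((2 * N / β) ^ k * (2 * N)) := by gcongr
      _ = _ := by rw [pow_succ]; field_simp

/-- For `α ≤ β` each of the `k + 1` monomials is at most `N β ^ k` in absolute value on the cube. -/
lemma slice_eq_zero (hαβ : α ≤ β) (k : ℕ) {s : ℝ} (hs : (k + 1) * N * β ^ k < |s|) :
    slice N α β k s = 0 := by
  induction k generalizing s with
  | zero =>
    simp only [slice]
    rw [if_neg]
    simpa using hs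
  | succ k ih =>
    simp only [slice]
    rw [mul_eq_zero]
    right
    have h : EqOn (fun f => slice N α β k ((s - f * α ^ (k + 1)) / β)) (fun _ => 0)
        (uIcc (-N) N) := by
      intro f hf
      rw [uIcc_of_le (by linarith)] at hf
      refine ih ?_
      rw [abs_div, abs_of_pos hβ, lt_div_iff₀ hβ]
      have h1 : |f * α ^ (k + 1)| ≤ N * β ^ (k + 1) := by
        rw [abs_mul, abs_of_nonneg (pow_nonneg hα _)]
        have := abs_le.mpr hf
        gcongr
      have h2 := abs_sub_abs_le_abs_sub s (f * α ^ (k + 1))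
      have h3 : ((k + 1 : ℕ) + 1 : ℝ) * N * β ^ (k + 1) =
        (k + 1) * N * β ^ k * β + N * β ^ (k + 1) := by push_cast; ring
      rw [h3] at hs
      linarith
    rw [intervalIntegral.integral_congr h]
    simp

end slice

/-- The integers `c` with `|c| ≤ N` and `b ∣ m - c * a`. -/
noncomputable def residueClass (N : ℕ) (a b m : ℤ) : Finset ℤ :=
  (Finset.Icc (-(N : ℤ)) N).filter fun c => b ∣ m - c * a

/-- As `a` is invertible modulo `b`, the divisibility condition is a single class `c = |b| n + r`.
Truncation to `[-N, N]` and this affine substitution preserve convexity of superlevel sets at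
thresholds `t ≥ 0`, so the error stays at most `M`, whatever `b` is. -/
lemma abs_sum_residueClass_sub_le {ψ : ℝ → ℝ} {M : ℝ} (h0 : ∀ x, 0 ≤ ψ x) (hM : ∀ x, ψ x ≤ M)
    (hconv : ∀ t, 0 ≤ t → Convex ℝ {x | t < ψ x}) (N : ℕ) {a b : ℤ} (hab : IsCoprime a b)
    (hb : b ≠ 0) (m : ℤ) :
    |∑ c ∈ residueClass N a b m, ψ c - |(b : ℝ)|⁻¹ * ∫ x in (-(N : ℝ))..N, ψ x| ≤ M := by
  obtain ⟨u, v, huv⟩ := hab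
  have hM0 : 0 ≤ M := (h0 0).trans (hM 0)
  set r : ℤ := u * m with hr
  have hclass : ∀ c : ℤ, b ∣ m - c * a ↔ ∃ n : ℤ, c = |b| * n + r := by
    intro c
    constructor
    · rintro ⟨d, hd⟩
      have : b ∣ c - r := ⟨c * v - u * d, by
        linear_combination (-c) * huv + (-u) * hd⟩
      obtain ⟨n, hn⟩ := (abs_dvd b _).mpr this
      exact ⟨n, by linarith⟩
    · rintro ⟨n, rfl⟩
      obtain ⟨e, he⟩ := (dvd_abs b b).mpr dvd_rfl
      exact ⟨m * v - e * n * a, by rw [he, hr]; linear_combination (-m) * huv⟩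
  set q : ℤ := |b| with hq
  have hq1 : (1 : ℤ) ≤ q := Int.one_le_abs hb
  have hq0 : (0 : ℝ) < q := by exact_mod_cast (by omega : 0 < q)
  set ψ₂ : ℝ → ℝ := (Icc (-(N : ℝ)) N).indicator ψ with hψ₂
  set ψ₁ : ℝ → ℝ := fun x => ψ₂ (q * x + r) with hψ₁
  have h20 : ∀ x, 0 ≤ ψ₂ x := fun x => indicator_nonneg (fun x _ => h0 x) x
  have h2M : ∀ x, ψ₂ x ≤ M := fun x => indicator_le' (fun x _ => hM x) (fun _ _ => hM0) x
  have h2conv : ∀ t, 0 ≤ t → Convex ℝ {x | t < ψ₂ x} := by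
    intro t ht
    have : {x | t < ψ₂ x} = Icc (-(N : ℝ)) N ∩ {x | t < ψ x} := by
      ext x
      by_cases hx : x ∈ Icc (-(N : ℝ)) N
      · simp [hψ₂, hx]
      · simp [hψ₂, hx, ht]
    rw [this]
    exact (convex_Icc _ _).inter (hconv t ht)
  have h1conv : ∀ t, 0 ≤ t → Convex ℝ {x | t < ψ₁ x} := by
    intro t ht
    rw [convex_iff_ordConnected]
    refine ordConnected_of_Ioo fun x hx y hy _ z hz => ?_
    refine (h2conv t ht).ordConnected.out (x := q * x + r) (y := q * y + r) hx hy ⟨?_, ?_⟩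
    · nlinarith [hz.1]
    · nlinarith [hz.2]
  have habs : ∀ x : ℝ, N + |(r : ℝ)| < |x| → ψ₁ x = 0 := by
    intro x hx
    refine indicator_of_notMem (fun hmem => ?_) _
    have h1 := abs_le.mpr hmem
    have h2 : |(q : ℝ) * x| = q * |x| := by rw [abs_mul, abs_of_pos hq0]
    have h3 : |(q : ℝ) * x| ≤ |q * x + r| + |(r : ℝ)| := by
      have := abs_sub (q * x + r : ℝ) r
      simpa using this
    have h4 : (1 : ℝ) ≤ q := by exact_mod_cast hq1
    nlinarith [abs_nonneg x]
  -- Since `q ≥ 1`, the condition `|q n + r| ≤ N` forces `|n| ≤ N + |r|`.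
  set s : Finset ℤ := Finset.Icc (-(N + |r|)) (N + |r|) with hs
  have hs' : ∀ n ∉ s, ψ₁ (n : ℤ) = 0 := by
    intro n hn
    refine habs n ?_
    have : (N : ℤ) + |r| < |n| := by
      by_contra h
      exact hn (Finset.mem_Icc.mpr (abs_le.mp (not_lt.mp h)))
    exact_mod_cast this
  have main := abs_sum_sub_integral_le (fun x => h20 _) (fun x => h2M _) h1conv habs s hs'
  have hsum : ∑ n ∈ s, ψ₁ n = ∑ c ∈ residueClass N a b m, ψ c := by
    symm
    have himg : residueClass N a b m = (s.filter fun n => |q * n + r| ≤ N).image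
        fun n => q * n + r := by
      ext c
      simp only [residueClass, Finset.mem_filter, Finset.mem_image, Finset.mem_Icc, hclass]
      constructor
      · rintro ⟨hc, n, rfl⟩
        refine ⟨n, ⟨?_, abs_le.mpr hc⟩, rfl⟩
        by_contra hn
        have h1 := hs' n hn
        have : (N : ℤ) + |r| < |n| := by
          by_contra h
          exact hn (Finset.mem_Icc.mpr (abs_le.mp (not_lt.mp h)))
        have h3 : |q * n| ≤ |q * n + r| + |r| := by
          have := abs_sub (q * n + r) r
          simpa using this
        rw [abs_mul, abs_of_pos (by omega : 0 < q)] at h3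
        have := abs_le.mpr hc
        nlinarith [abs_nonneg n]
      · rintro ⟨n, ⟨_, hn⟩, rfl⟩
        exact ⟨abs_le.mp hn, n, rfl⟩
    rw [himg, Finset.sum_image, Finset.sum_filter]
    · refine Finset.sum_congr rfl fun n _ => ?_
      simp only [hψ₁, hψ₂, indicator, mem_Icc]
      have : |q * n + r| ≤ N ↔ -(N : ℝ) ≤ q * n + r ∧ (q * n + r : ℝ) ≤ N := by
        rw [abs_le]; norm_cast
      simp only [this]
      push_cast
      rfl
    · intro x _ y _ hxy
      have : q * x = q * y := by simpa using hxy
      exact mul_left_cancel₀ (by omega) this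
  have hint : ∫ x, ψ₁ x = |(b : ℝ)|⁻¹ * ∫ x in (-(N : ℝ))..N, ψ x := by
    have e1 := Measure.integral_comp_mul_left (fun y => ψ₂ (y + r)) (q : ℝ)
    rw [integral_add_right_eq_self (μ := volume) ψ₂ (r : ℝ)] at e1
    simp only [hψ₁]
    rw [e1, hψ₂, integral_indicator measurableSet_Icc,
      intervalIntegral.integral_of_le (by linarith [(Nat.cast_nonneg N : (0 : ℝ) ≤ N)]),
      integral_Icc_eq_integral_Ioc, smul_eq_mul, abs_of_pos (inv_pos.mpr hq0), hq]
    push_cast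
    rfl
  rw [← hsum, ← hint]
  exact main

lemma card_residueClass_le (N : ℕ) {a b : ℤ} (hab : IsCoprime a b) (hb : b ≠ 0) (m : ℤ) :
    ((residueClass N a b m).card : ℝ) ≤ 1 + 2 * N / |(b : ℝ)| := by
  have h := abs_sum_residueClass_sub_le (ψ := fun _ => 1) (M := 1) (fun _ => zero_le_one)
    (fun _ => le_rfl) (fun t _ => by
      by_cases h : t < 1
      · simpa [h] using convex_univ
      · simpa [h] using convex_empty) N hab hb m
  simp only [Finset.sum_const, nsmul_eq_mul, mul_one, intervalIntegral.integral_const,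
    smul_eq_mul] at h
  have h2 := (abs_le.mp h).2
  have : |(b : ℝ)|⁻¹ * ((N : ℝ) - -N) = 2 * N / |(b : ℝ)| := by ring
  linarith

end GenusTwo

/-! ### Forms in a box with a prescribed value at `(a, b)` -/

namespace GenusTwo

open MeasureTheory Set

/-- The forms `∑ i, f i * x ^ i * z ^ (k - i)` with integral coefficients bounded by `N` that take
the value `m` at `(a, b)`. -/
noncomputable def solutions (N : ℕ) (a b : ℤ) (k : ℕ) (m : ℤ) : Finset (Fin (k + 1) → ℤ) :=
  (Fintype.piFinset fun _ : Fin (k + 1) => Finset.Icc (-(N : ℤ)) N).filter fun f =>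
    ∑ i, f i * a ^ (i : ℕ) * b ^ (k - (i : ℕ)) = m

section solutions

variable {N : ℕ} {a b : ℤ}

lemma sum_form_succ (k : ℕ) (f : Fin (k + 2) → ℤ) :
    ∑ i, f i * a ^ (i : ℕ) * b ^ (k + 1 - (i : ℕ)) =
      b * (∑ i, (Fin.init f : Fin (k + 1) → ℤ) i * a ^ (i : ℕ) * b ^ (k - (i : ℕ))) +
        f (Fin.last _) * a ^ (k + 1) := by
  rw [Fin.sum_univ_castSucc, Finset.mul_sum]
  congr 1
  · refine Finset.sum_congr rfl fun i _ => ?_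
    have : k + 1 - (i : ℕ) = (k - i) + 1 := by have := i.2; omega
    simp only [Fin.init, Fin.val_castSucc, this, pow_succ]
    ring
  · simp

/-- This drives every induction on the degree: modulo `b` only the top coefficient contributes to
the value, and once it lies in the right class the division by `b` is exact. -/
lemma mem_solutions_succ (hb : b ≠ 0) {k : ℕ} {m : ℤ} {f : Fin (k + 2) → ℤ} :
    f ∈ solutions N a b (k + 1) m ↔ f (Fin.last _) ∈ residueClass N (a ^ (k + 1)) b m ∧
      (Fin.init f : Fin (k + 1) → ℤ) ∈
        solutions N a b k ((m - f (Fin.last _) * a ^ (k + 1)) / b) := by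
  simp only [solutions, residueClass, Finset.mem_filter, Fintype.mem_piFinset, sum_form_succ,
    Fin.forall_fin_succ' (n := k + 1), Fin.init]
  constructor
  · rintro ⟨⟨h1, h2⟩, h3⟩
    have h4 : m - f (Fin.last _) * a ^ (k + 1) = b * (∑ i : Fin (k + 1),
        f i.castSucc * a ^ (i : ℕ) * b ^ (k - (i : ℕ))) := by linarith
    exact ⟨⟨h2, Dvd.intro _ h4.symm⟩, h1, by rw [h4, Int.mul_ediv_cancel_left _ hb]⟩
  · rintro ⟨⟨h2, h4⟩, h1, h3⟩
    refine ⟨⟨h1, h2⟩, ?_⟩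
    rw [h3, Int.mul_ediv_cancel' h4]
    ring

lemma card_solutions_succ (hb : b ≠ 0) (k : ℕ) (m : ℤ) :
    (solutions N a b (k + 1) m).card = ∑ c ∈ residueClass N (a ^ (k + 1)) b m,
      (solutions N a b k ((m - c * a ^ (k + 1)) / b)).card := by
  rw [Finset.card_eq_sum_card_fiberwise (f := fun f => f (Fin.last _))
    (t := residueClass N (a ^ (k + 1)) b m) fun f hf => ((mem_solutions_succ hb).mp hf).1]
  refine Finset.sum_congr rfl fun c hc => ?_
  refine Finset.card_bij' (fun f _ => Fin.init f)
    (fun g _ => (Fin.snoc g c : Fin (k + 2) → ℤ)) ?_ ?_ ?_ ?_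
  · intro f hf
    rw [Finset.mem_filter] at hf
    rw [← hf.2]
    exact ((mem_solutions_succ hb).mp hf.1).2
  · intro g hg
    rw [Finset.mem_filter, mem_solutions_succ hb]
    simpa [hc] using hg
  · intro f hf
    rw [Finset.mem_filter] at hf
    rw [← hf.2]
    exact Fin.snoc_init_self f
  · intro g _
    simp

/-- If at most `D` members of a set of forms with a fixed value at `(a, b)` share their coefficients
with index at least `d`, then the set has at most `D * (1 + 2 * N / |b|) ^ (k + 1 - d)` members. -/
lemma card_le_of_tails (hab : IsCoprime a b) (hb : b ≠ 0) {d D : ℕ} (hd : 1 ≤ d) (k : ℕ)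
    (hdk : d ≤ k + 1) (m : ℤ) (S : Finset (Fin (k + 1) → ℤ)) (hS : S ⊆ solutions N a b k m)
    (hD : ∀ f ∈ S, (S.filter fun f' => ∀ i : Fin (k + 1), d ≤ (i : ℕ) → f' i = f i).card ≤ D) :
    (S.card : ℝ) ≤ D * (1 + 2 * N / |(b : ℝ)|) ^ (k + 1 - d) := by
  -- When `d` is the number of coefficients, the condition on the tail is void and `D` bounds all of
  -- `S`.
  have base : ∀ {n : ℕ} (S : Finset (Fin n → ℤ)), d = n →
      (∀ f ∈ S, (S.filter fun f' => ∀ i : Fin n, d ≤ (i : ℕ) → f' i = f i).card ≤ D) →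
      (S.card : ℝ) ≤ D * (1 + 2 * N / |(b : ℝ)|) ^ (n - d) := by
    intro n S h hD
    rw [h, Nat.sub_self, pow_zero, mul_one]
    rcases S.eq_empty_or_nonempty with rfl | ⟨f, hf⟩
    · simp
    · have := hD f hf
      rw [Finset.filter_true_of_mem] at this
      · exact_mod_cast this
      · intro f' _ i hi
        have := i.2
        omega
  induction k generalizing m with
  | zero => exact base S (by omega) hD
  | succ k ih =>
    rcases hdk.eq_or_lt with h | hlt
    · exact base S h hD
    -- Fixing the top coefficient and deleting it gives the same situation one degree lower. The
    -- admissible `c` supply one factor `1 + 2 * N / |b|`.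
    have hfib : ∀ c ∈ residueClass N (a ^ (k + 1)) b m,
        ((S.filter fun f => f (Fin.last _) = c).card : ℝ) ≤
          D * (1 + 2 * N / |(b : ℝ)|) ^ (k + 1 - d) := by
      intro c _
      set T : Finset (Fin (k + 1) → ℤ) := (S.filter fun f => f (Fin.last _) = c).image Fin.init
        with hT
      have hinj : Set.InjOn (Fin.init : (Fin (k + 2) → ℤ) → Fin (k + 1) → ℤ)
          (S.filter fun f => f (Fin.last _) = c) := by
        intro f hf g hg hfg
        rw [Finset.coe_filter] at hf hg
        rw [← Fin.snoc_init_self f, ← Fin.snoc_init_self g, hfg, hf.2, hg.2]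
      have hcard : T.card = (S.filter fun f => f (Fin.last _) = c).card :=
        Finset.card_image_of_injOn hinj
      have hTS : T ⊆ solutions N a b k ((m - c * a ^ (k + 1)) / b) := by
        intro g hg
        rw [hT, Finset.mem_image] at hg
        obtain ⟨f, hf, rfl⟩ := hg
        rw [Finset.mem_filter] at hf
        rw [← hf.2]
        exact ((mem_solutions_succ hb).mp (hS hf.1)).2
      have hTD : ∀ g ∈ T,
          (T.filter fun g' => ∀ i : Fin (k + 1), d ≤ (i : ℕ) → g' i = g i).card ≤ D := by
        intro g hg
        rw [hT, Finset.mem_image] at hg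
        obtain ⟨f, hf, rfl⟩ := hg
        refine le_trans ?_ (hD f (Finset.mem_filter.mp hf).1)
        rw [hT, Finset.filter_image]
        refine Finset.card_image_le.trans (Finset.card_le_card fun f' hf' => ?_)
        simp only [Finset.mem_filter] at hf' hf ⊢
        refine ⟨hf'.1.1, fun i => ?_⟩
        refine Fin.lastCases (fun _ => ?_) (fun i hi => ?_) i
        · rw [hf'.1.2, hf.2]
        · exact hf'.2 i hi
      rw [← hcard]
      exact ih (Nat.lt_succ_iff.mp hlt) _ T hTS hTD
    rw [Finset.card_eq_sum_card_fiberwise (f := fun f => f (Fin.last _))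
      (t := residueClass N (a ^ (k + 1)) b m) fun f hf => ((mem_solutions_succ hb).mp (hS hf)).1]
    push_cast
    refine (Finset.sum_le_sum hfib).trans ?_
    rw [Finset.sum_const, nsmul_eq_mul, show k + 1 + 1 - d = (k + 1 - d) + 1 by omega]
    have h1 := card_residueClass_le N (hab.pow_left (m := k + 1)) hb m
    have h2 : (0 : ℝ) ≤ D * (1 + 2 * N / |(b : ℝ)|) ^ (k + 1 - d) := by positivity
    calc _ ≤ _ := mul_le_mul_of_nonneg_right h1 h2
      _ = _ := by ring

/-- The recursion for `slice` uses absolute values. The sign of `b` is absorbed by evenness, that of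
`a ^ (k + 1)` by `f ↦ -f`. -/
lemma slice_succ_int (hb : b ≠ 0) (k : ℕ) (m : ℤ) :
    slice N |(a : ℝ)| |(b : ℝ)| (k + 1) m = |(b : ℝ)|⁻¹ *
      ∫ f in (-(N : ℝ))..N, slice N |(a : ℝ)| |(b : ℝ)| k ((m - f * a ^ (k + 1)) / b) := by
  have hb' : 0 < |(b : ℝ)| := abs_pos.mpr (by exact_mod_cast hb)
  have hE := slice_evenUnimodal (N := (N : ℝ)) (α := |(a : ℝ)|) (Nat.cast_nonneg N)
    (abs_nonneg _) hb' k
  simp only [slice]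
  congr 1
  have hdiv : ∀ x : ℝ, |(x / |(b : ℝ)|)| = |x / b| := fun x => by rw [abs_div, abs_div, abs_abs]
  rcases le_total 0 ((a : ℝ) ^ (k + 1)) with h | h
  · refine intervalIntegral.integral_congr fun f _ => hE.apply_eq ?_
    rw [hdiv, ← abs_pow, abs_of_nonneg h]
  · have e := intervalIntegral.integral_comp_neg (a := -(N : ℝ)) (b := N)
      fun f => slice N |(a : ℝ)| |(b : ℝ)| k ((m - f * |(a : ℝ)| ^ (k + 1)) / |(b : ℝ)|)
    rw [neg_neg] at e
    rw [← e]
    refine intervalIntegral.integral_congr fun f _ => hE.apply_eq ?_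
    rw [hdiv, ← abs_pow, abs_of_nonpos h, neg_mul_neg]

/-- The number of forms with a given value at `(a, b)` is approximated by `slice`. -/
lemma abs_card_solutions_sub_slice_le (hab : IsCoprime a b) (hb : b ≠ 0) (k : ℕ) (m : ℤ) :
    |((solutions N a b (k + 1) m).card : ℝ) - slice N |(a : ℝ)| |(b : ℝ)| (k + 1) m| ≤
      (k + 1) * (1 + 2 * N / |(b : ℝ)|) ^ k := by
  have hb' : 0 < |(b : ℝ)| := abs_pos.mpr (by exact_mod_cast hb)
  have hN : (0 : ℝ) ≤ N := Nat.cast_nonneg N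
  -- One step of the recursion, with densities in place of counts: the error is at most the maximum
  -- of the density, `(2 * N / |b|) ^ k`.
  have step : ∀ k (m : ℤ), |∑ c ∈ residueClass N (a ^ (k + 1)) b m,
      slice N |(a : ℝ)| |(b : ℝ)| k (((m - c * a ^ (k + 1)) / b : ℤ) : ℝ) -
        slice N |(a : ℝ)| |(b : ℝ)| (k + 1) m| ≤ (1 + 2 * N / |(b : ℝ)|) ^ k := by
    intro k m
    have hE := slice_evenUnimodal hN (abs_nonneg (a : ℝ)) hb' k
    have h := abs_sum_residueClass_sub_le
      (ψ := fun f => slice N |(a : ℝ)| |(b : ℝ)| k ((m - f * a ^ (k + 1)) / b))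
      (M := (1 + 2 * N / |(b : ℝ)|) ^ k) (fun x => slice_nonneg hN (abs_nonneg _) hb' k _)
      (fun x => (slice_le hN (abs_nonneg _) hb' k _).trans
        (pow_le_pow_left₀ (by positivity) (by linarith) k))
      (fun t _ => ?_) N (hab.pow_left (m := k + 1)) hb m
    · rw [slice_succ_int hb]
      refine le_of_eq_of_le ?_ h
      congr 2
      refine Finset.sum_congr rfl fun c hc => ?_
      simp only [residueClass, Finset.mem_filter] at hc
      rw [Int.cast_div hc.2 (by exact_mod_cast hb)]
      push_cast
      rfl
    · have := (hE.convex t).affine_preimage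
        (AffineMap.lineMap ((m : ℝ) / b) (((m : ℝ) - a ^ (k + 1)) / b) : ℝ →ᵃ[ℝ] ℝ)
      have e : ∀ f, (AffineMap.lineMap ((m : ℝ) / b) (((m : ℝ) - a ^ (k + 1)) / b) : ℝ →ᵃ[ℝ] ℝ) f =
          (m - f * a ^ (k + 1)) / b := by
        intro f
        rw [AffineMap.lineMap_apply]
        simp only [vsub_eq_sub, smul_eq_mul, vadd_eq_add]
        ring
      simpa only [preimage_ofPred_eq, e] using this
  induction k generalizing m with
  | zero =>
    have h := step 0 m
    rw [card_solutions_succ hb]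
    push_cast
    refine le_of_eq_of_le ?_ (h.trans (by simp))
    congr 2
    refine Finset.sum_congr rfl fun c _ => ?_
    generalize (m - c * a ^ (0 + 1)) / b = n
    simp only [slice]
    -- In degree `0` count and density coincide, so the base case carries only the error of `step`.
    have h1 : solutions N a b 0 n = if |n| ≤ N then {fun _ => n} else ∅ := by
      ext f
      have : (f = fun _ => n) ↔ f 0 = n :=
        ⟨fun h => by rw [h], fun h => by ext i; rw [Fin.fin_one_eq_zero i, h]⟩
      split_ifs with h
      · simp only [solutions, Finset.mem_filter, Fintype.mem_piFinset, Finset.mem_singleton, this]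
        rw [abs_le] at h
        simp [Fin.forall_fin_one]
        intro h; simp_all
      · rw [abs_le] at h
        simp only [solutions, Finset.mem_filter, Fintype.mem_piFinset]
        simp [Fin.forall_fin_one]
        rintro h1 h2 rfl
        exact h ⟨h1, h2⟩
    rw [h1]
    have h2 : |(n : ℝ)| ≤ N ↔ |n| ≤ N := by norm_cast
    simp only [h2]
    split_ifs <;> simp
  | succ k ih =>
    have h := step (k + 1) m
    -- The inherited error is multiplied by the number of admissible top coefficients; `step` adds
    -- one more unit to the factor.
    have h1 : |((solutions N a b (k + 1 + 1) m).card : ℝ) -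
        ∑ c ∈ residueClass N (a ^ (k + 1 + 1)) b m,
          slice N |(a : ℝ)| |(b : ℝ)| (k + 1) (((m - c * a ^ (k + 1 + 1)) / b : ℤ) : ℝ)| ≤
        (k + 1) * (1 + 2 * N / |(b : ℝ)|) ^ (k + 1) := by
      rw [card_solutions_succ hb]
      push_cast
      rw [← Finset.sum_sub_distrib]
      refine (Finset.abs_sum_le_sum_abs _ _).trans ?_
      refine (Finset.sum_le_sum fun c _ => ih ((m - c * a ^ (k + 1 + 1)) / b)).trans ?_
      rw [Finset.sum_const, nsmul_eq_mul]
      have h1 := card_residueClass_le N (hab.pow_left (m := k + 1 + 1)) hb m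
      have h2 : (0 : ℝ) ≤ (k + 1) * (1 + 2 * N / |(b : ℝ)|) ^ k := by positivity
      calc _ ≤ _ := mul_le_mul_of_nonneg_right h1 h2
        _ = _ := by ring
    have h2 := abs_sub_le ((solutions N a b (k + 1 + 1) m).card : ℝ)
      (∑ c ∈ residueClass N (a ^ (k + 1 + 1)) b m,
        slice N |(a : ℝ)| |(b : ℝ)| (k + 1) (((m - c * a ^ (k + 1 + 1)) / b : ℤ) : ℝ))
      (slice N |(a : ℝ)| |(b : ℝ)| (k + 1 + 1) m)
    push_cast
    linarith

end solutions

end GenusTwo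

/-! ### Integrating the densities: signed sums and `φ` -/

namespace GenusTwo

open MeasureTheory Set

section fubini

variable {N α β : ℝ}

/-- With the argument of the lower density as variable, `s` enters only through an indicator, so an
outer integration over `s` can be done first. -/
lemma slice_succ_eq_integral (hN : 0 ≤ N) (hα : 0 < α) (hβ : 0 < β) (k : ℕ) (s : ℝ) :
    slice N α β (k + 1) s = (α ^ (k + 1))⁻¹ *
      ∫ u, slice N α β k u * (if |s - β * u| ≤ N * α ^ (k + 1) then 1 else 0) := by
  have hα' : 0 < α ^ (k + 1) := pow_pos hα _
  simp only [slice]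
  generalize α ^ (k + 1) = a at *
  generalize slice N α β k = g
  have h := intervalIntegral.integral_comp_sub_mul (a := -N) (b := N) g
    (c := a / β) (by positivity) (s / β)
  have h1 : ∀ f, g ((s - f * a) / β) = g (s / β - a / β * f) := by
    intro f; congr 1; field_simp
  have h2 : ∀ u, g u * (if |s - β * u| ≤ N * a then 1 else 0) =
      (Icc (s / β - a / β * N) (s / β - a / β * -N)).indicator g u := by
    intro u
    have e1 : s / β - a / β * N = (s - N * a) / β := by field_simp
    have e2 : s / β - a / β * -N = (s + N * a) / β := by field_simp; ring
    have : |s - β * u| ≤ N * a ↔ u ∈ Icc (s / β - a / β * N) (s / β - a / β * -N) := by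
      rw [e1, e2, abs_le, mem_Icc, div_le_iff₀ hβ, le_div_iff₀ hβ]
      constructor <;> rintro ⟨_, _⟩ <;> constructor <;> linarith
    by_cases hu : |s - β * u| ≤ N * a
    · rw [if_pos hu, indicator_of_mem (this.mp hu), mul_one]
    · rw [if_neg hu, indicator_of_notMem (fun h => hu (this.mpr h)), mul_zero]
  simp only [h1, h2]
  have hle : s / β - a / β * N ≤ s / β - a / β * -N := by
    have : 0 ≤ a / β * N := by positivity
    linarith
  rw [h, integral_indicator measurableSet_Icc, integral_Icc_eq_integral_Ioc,
    ← intervalIntegral.integral_of_le hle, smul_eq_mul]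
  field_simp

/-- Fubini. Properness of `σ` confines the integrand to a compact set. The cases needed are `σ y =
y` with a truncated power as weight, and `σ y = y ^ 2` with weight `1`. -/
lemma integral_mul_slice_succ (hN : 0 ≤ N) (hα : 0 < α) (hβ : 0 < β) (hαβ : α ≤ β) (k : ℕ)
    {w σ : ℝ → ℝ} (hw : Continuous w) (hσ : Continuous σ)
    (hproper : ∀ B, Bornology.IsBounded {y | |σ y| ≤ B}) :
    ∫ y, w y * slice N α β (k + 1) (σ y) = (α ^ (k + 1))⁻¹ * ∫ u, slice N α β k u *
      ∫ y, w y * (if |σ y - β * u| ≤ N * α ^ (k + 1) then 1 else 0) := by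
  set a := α ^ (k + 1) with ha
  have ha0 : 0 < a := pow_pos hα _
  set g := slice N α β k with hg
  have hE := slice_evenUnimodal hN hα.le hβ k
  have hg0 := slice_nonneg hN hα.le hβ k
  set F : ℝ → ℝ → ℝ := fun y u => w y * (g u * (if |σ y - β * u| ≤ N * a then 1 else 0)) with hF
  set B := (k + 1) * N * β ^ k with hB
  set K : Set ℝ := {y | |σ y| ≤ β * B + N * a} with hK
  have hKc : IsCompact K := Metric.isCompact_of_isClosed_isBounded
    (isClosed_le (by fun_prop) continuous_const) (hproper _)
  obtain ⟨C, hC⟩ := hKc.exists_bound_of_continuousOn hw.continuousOn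
  have hsupp : Function.support (Function.uncurry F) ⊆ K ×ˢ Icc (-B) B := by
    rintro ⟨y, u⟩ h
    simp only [Function.mem_support, Function.uncurry_apply_pair, hF] at h
    have hu : |u| ≤ B := by
      by_contra hcon
      rw [hg, slice_eq_zero hN hα.le hβ hαβ k (not_le.mp hcon)] at h
      simp at h
    have hy : |σ y - β * u| ≤ N * a := by
      by_contra hcon
      rw [if_neg hcon] at h
      simp at h
    refine ⟨?_, abs_le.mp hu⟩
    have h1 : |σ y| ≤ |σ y - β * u| + |β * u| := by
      have := abs_add_le (σ y - β * u) (β * u)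
      simpa using this
    have h2 : |β * u| ≤ β * B := by
      rw [abs_mul, abs_of_pos hβ]
      gcongr
    simp only [hK, mem_ofPred_eq]
    linarith
  have hmeas : Measurable (Function.uncurry F) := by
    have h1 : Measurable fun p : ℝ × ℝ => w p.1 := hw.measurable.comp measurable_fst
    have h2 : Measurable fun p : ℝ × ℝ => g p.2 := hE.measurable.comp measurable_snd
    have h3 : MeasurableSet {p : ℝ × ℝ | |σ p.1 - β * p.2| ≤ N * a} :=
      (isClosed_le (by fun_prop) continuous_const).measurableSet
    exact h1.mul (h2.mul (Measurable.ite h3 measurable_const measurable_const))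
  have hint : Integrable (Function.uncurry F) (volume.prod volume) := by
    rw [← integrableOn_iff_integrable_of_support_subset hsupp]
    refine Measure.integrableOn_of_bounded (M := C * g 0) ?_ hmeas.aestronglyMeasurable ?_
    · exact ((hKc.prod isCompact_Icc).measure_lt_top).ne
    · refine (ae_restrict_iff' (hKc.measurableSet.prod measurableSet_Icc)).mpr
        (Eventually.of_forall ?_)
      rintro ⟨y, u⟩ ⟨hy, _⟩
      simp only [Function.uncurry_apply_pair, hF, norm_mul]
      have h1 := hC y hy
      have h2 : ‖g u‖ ≤ g 0 := by
        rw [Real.norm_of_nonneg (hg0 u)]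
        exact hE _ _ (by simp)
      have h3 : ‖(if |σ y - β * u| ≤ N * a then (1 : ℝ) else 0)‖ ≤ 1 := by
        split_ifs <;> simp
      have h4 : ‖g u‖ * ‖(if |σ y - β * u| ≤ N * a then (1 : ℝ) else 0)‖ ≤ g 0 * 1 :=
        mul_le_mul h2 h3 (norm_nonneg _) (hg0 0)
      rw [mul_one] at h4
      exact mul_le_mul h1 h4 (by positivity) ((norm_nonneg _).trans h1)
  have hswap := integral_integral_swap hint
  simp only [hF] at hswap
  calc ∫ y, w y * slice N α β (k + 1) (σ y)
      = ∫ y, a⁻¹ * ∫ u, w y * (g u * (if |σ y - β * u| ≤ N * a then 1 else 0)) := by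
        congr 1; ext y
        rw [slice_succ_eq_integral hN hα hβ, integral_const_mul]
        ring
    _ = _ := by
        rw [integral_const_mul, hswap]
        congr 2; ext u
        rw [← integral_const_mul]
        congr 1; ext y
        ring

end fubini

/-- The truncated power `max x 0 ^ p`. -/
noncomputable def truncPow (p x : ℝ) : ℝ := max x 0 ^ p

lemma continuous_truncPow {p : ℝ} (hp : 0 ≤ p) : Continuous (truncPow p) :=
  (continuous_id.max continuous_const).rpow_const fun _ => Or.inr hp

lemma integral_truncPow {p : ℝ} (hp : 0 < p) (a b : ℝ) :
    ∫ t in a..b, truncPow p t = (truncPow (p + 1) b - truncPow (p + 1) a) / (p + 1) := by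
  have h0 : ∀ b, ∫ t in (0 : ℝ)..b, truncPow p t = truncPow (p + 1) b / (p + 1) := by
    intro b
    rcases le_total 0 b with hb | hb
    · have : EqOn (truncPow p) (fun t => t ^ p) (uIcc 0 b) := by
        intro t ht
        rw [uIcc_of_le hb] at ht
        simp only [truncPow, max_eq_left ht.1]
      rw [intervalIntegral.integral_congr this, integral_rpow (Or.inl (by linarith)),
        Real.zero_rpow (by linarith), truncPow, max_eq_left hb, sub_zero]
    · have : EqOn (truncPow p) (fun _ => 0) (uIcc 0 b) := by
        intro t ht
        rw [uIcc_of_ge hb] at ht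
        simp only [truncPow, max_eq_right ht.2, Real.zero_rpow hp.ne']
      rw [intervalIntegral.integral_congr this, truncPow, max_eq_right hb,
        Real.zero_rpow (by linarith)]
      simp
  have hc : ∀ x y, IntervalIntegrable (truncPow p) volume x y := fun x y =>
    (continuous_truncPow hp.le).intervalIntegrable x y
  rw [← intervalIntegral.integral_interval_sub_left (hc 0 b) (hc 0 a), h0, h0, sub_div]

/-- Integration over one coefficient raises the exponent by one and takes a difference; this is
where the factors `ε_i` in `φ` come from. -/
lemma integral_truncPow_window {p c : ℝ} (hp : 0 < p) (hc : 0 < c) (x v d : ℝ) (hd : 0 ≤ d) :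
    ∫ y, truncPow p (c * y + x) * (if |y - v| ≤ d then 1 else 0) =
      (truncPow (p + 1) (c * v + (x + c * d)) - truncPow (p + 1) (c * v + (x - c * d))) /
        (c * (p + 1)) := by
  have h : ∀ y, truncPow p (c * y + x) * (if |y - v| ≤ d then 1 else 0) =
      (Icc (v - d) (v + d)).indicator (fun y => truncPow p (c * y + x)) y := by
    intro y
    have : |y - v| ≤ d ↔ y ∈ Icc (v - d) (v + d) := by
      rw [abs_le, mem_Icc]
      constructor <;> rintro ⟨_, _⟩ <;> constructor <;> linarith
    by_cases hu : |y - v| ≤ d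
    · rw [if_pos hu, indicator_of_mem (this.mp hu), mul_one]
    · rw [if_neg hu, indicator_of_notMem (fun h => hu (this.mpr h)), mul_zero]
  simp only [h]
  rw [integral_indicator measurableSet_Icc, integral_Icc_eq_integral_Ioc,
    ← intervalIntegral.integral_of_le (by linarith),
    intervalIntegral.integral_comp_mul_add (truncPow p) hc.ne', integral_truncPow hp, smul_eq_mul,
    show c * (v + d) + x = c * v + (x + c * d) by ring,
    show c * (v - d) + x = c * v + (x - c * d) by ring]
  field_simp

lemma truncPow_half (x : ℝ) : truncPow (1 / 2) x = √x := by
  rw [truncPow, ← Real.sqrt_eq_rpow]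
  rcases le_total 0 x with h | h
  · rw [max_eq_left h]
  · rw [max_eq_right h, Real.sqrt_zero, Real.sqrt_eq_zero_of_nonpos h]

/-- The set `v - d ≤ y² ≤ v + d` is symmetric, of length `2 (√(v + d) - √(v - d))`, with `√` zero on
negative numbers. This starts the exponents at `1 / 2`. -/
lemma integral_sq_window (v d : ℝ) (hd : 0 ≤ d) :
    ∫ y : ℝ, (1 : ℝ) * (if |y ^ 2 - v| ≤ d then 1 else 0) =
      2 * (truncPow (1 / 2) (v + d) - truncPow (1 / 2) (v - d)) := by
  rw [truncPow_half, truncPow_half]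
  have hle : √(v - d) ≤ √(v + d) := Real.sqrt_le_sqrt (by linarith)
  have hset : ∀ y : ℝ, |y ^ 2 - v| ≤ d ↔ 0 ≤ v + d ∧
      y ∈ Icc (-√(v + d)) √(v + d) \ Ioo (-√(v - d)) √(v - d) := by
    intro y
    rw [Set.mem_sdiff, mem_Icc, mem_Ioo, ← abs_le, ← abs_lt, abs_le, not_lt, ← Real.sqrt_sq_eq_abs]
    constructor
    · rintro ⟨h1, h2⟩
      have : 0 ≤ v + d := by nlinarith [sq_nonneg y]
      exact ⟨this, Real.sqrt_le_sqrt (by linarith), Real.sqrt_le_sqrt (by linarith)⟩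
    · rintro ⟨h0, h1, h2⟩
      rw [Real.sqrt_le_sqrt_iff h0] at h1
      rw [Real.sqrt_le_sqrt_iff (sq_nonneg y)] at h2
      constructor <;> linarith
  rcases lt_or_ge (v + d) 0 with h0 | h0
  · rw [Real.sqrt_eq_zero_of_nonpos h0.le, Real.sqrt_eq_zero_of_nonpos (by linarith : v - d ≤ 0)]
    have : ∀ y : ℝ, ¬ |y ^ 2 - v| ≤ d := fun y hy => absurd ((hset y).mp hy).1 (not_le.mpr h0)
    simp [this]
  · have h : ∀ y : ℝ, (1 : ℝ) * (if |y ^ 2 - v| ≤ d then 1 else 0) =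
        (Icc (-√(v + d)) √(v + d) \ Ioo (-√(v - d)) √(v - d)).indicator (fun _ => 1) y := by
      intro y
      rw [one_mul, indicator_apply]
      simp only [hset y, h0, true_and]
    simp only [h]
    rw [integral_indicator (measurableSet_Icc.diff measurableSet_Ioo), setIntegral_const,
      smul_eq_mul, mul_one, measureReal_sdiff _ measurableSet_Ioo (h₁ := measure_Icc_lt_top.ne)]
    · rw [Real.volume_real_Icc_of_le (by linarith [Real.sqrt_nonneg (v + d)]),
        Real.volume_real_Ioo_of_le (by linarith [Real.sqrt_nonneg (v - d)])]
      ring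
    · intro y hy
      exact ⟨by linarith [hy.1], by linarith [hy.2]⟩

/-- `∑ ε, (∏ i, ε i) * truncPow q (x + c * N * ∑ i, ε i * α ^ i * β ^ (k - i))` over all sign
vectors `ε`. -/
noncomputable def signedSum (N α β q : ℝ) (k : ℕ) (c x : ℝ) : ℝ :=
  ∑ ε : Fin (k + 1) → ℤˣ, (∏ i, ((ε i : ℤ) : ℝ)) *
    truncPow q (x + c * N * ∑ i, ((ε i : ℤ) : ℝ) * α ^ (i : ℕ) * β ^ (k - (i : ℕ)))

lemma sum_int_units (F : ℤˣ → ℝ) : ∑ e, F e = F 1 + F (-1) := by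
  rw [UnitsInt.univ, Finset.sum_pair (by decide)]

section signedSum

variable {N α β : ℝ}

lemma signedSum_zero (q c x : ℝ) : signedSum N α β q 0 c x =
    truncPow q (x + c * N) - truncPow q (x - c * N) := by
  rw [signedSum, Fintype.sum_equiv (Equiv.funUnique (Fin 1) ℤˣ) _
    (fun e : ℤˣ => ((e : ℤ) : ℝ) * truncPow q (x + c * N * ((e : ℤ) : ℝ))), sum_int_units]
  · simp [sub_eq_add_neg]
  · intro ε
    simp

/-- The top sign shifts `x`; the remaining monomials share a factor `β`, which goes into `c`. -/
lemma signedSum_succ (q : ℝ) (k : ℕ) (c x : ℝ) : signedSum N α β q (k + 1) c x =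
    signedSum N α β q k (c * β) (x + c * (N * α ^ (k + 1))) -
      signedSum N α β q k (c * β) (x - c * (N * α ^ (k + 1))) := by
  rw [signedSum, ← Fintype.sum_equiv (Fin.snocEquiv fun _ : Fin (k + 2) => ℤˣ)
    (fun p => (((p.1 : ℤˣ) : ℤ) : ℝ) * ((∏ i, ((p.2 i : ℤ) : ℝ)) *
      truncPow q (x + c * (N * α ^ (k + 1)) * ((p.1 : ℤ) : ℝ) + c * β * N *
        ∑ i : Fin (k + 1), ((p.2 i : ℤ) : ℝ) * α ^ (i : ℕ) * β ^ (k - (i : ℕ))))),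
    Fintype.sum_prod_type, sum_int_units]
  · simp only [signedSum]
    rw [sub_eq_add_neg, ← Finset.sum_neg_distrib]
    congr 1
    · simp
    · refine Finset.sum_congr rfl fun ε _ => ?_
      push_cast
      ring_nf
  · rintro ⟨e, ε⟩
    rw [Fin.prod_univ_castSucc (n := k + 1), Fin.sum_univ_castSucc (n := k + 1)]
    simp only [Fin.snocEquiv, Equiv.coe_fn_mk, Fin.snoc_castSucc, Fin.snoc_last]
    have : ∑ i : Fin (k + 1), ((ε i : ℤ) : ℝ) * α ^ ((i.castSucc : Fin (k + 2)) : ℕ) *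
        β ^ (k + 1 - ((i.castSucc : Fin (k + 2)) : ℕ)) =
        β * ∑ i : Fin (k + 1), ((ε i : ℤ) : ℝ) * α ^ (i : ℕ) * β ^ (k - (i : ℕ)) := by
      rw [Finset.mul_sum]
      refine Finset.sum_congr rfl fun i _ => ?_
      have : k + 1 - (i : ℕ) = (k - i) + 1 := by have := i.2; omega
      simp only [Fin.val_castSucc, this, pow_succ]
      ring
    rw [this, Fin.val_last, Nat.sub_self, pow_zero, mul_one]
    generalize ∑ i : Fin (k + 1), ((ε i : ℤ) : ℝ) * α ^ (i : ℕ) * β ^ (k - (i : ℕ)) = S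
    rw [show x + c * N * (β * S + ((e : ℤ) : ℝ) * α ^ (k + 1)) =
      x + c * (N * α ^ (k + 1)) * ((e : ℤ) : ℝ) + c * β * N * S by ring]
    ring

lemma prod_pow_succ (k : ℕ) : ∏ i ∈ Finset.range (k + 2), (α ^ i * β ^ (k + 1 - i)) =
    α ^ (k + 1) * (β ^ (k + 1) * ∏ i ∈ Finset.range (k + 1), (α ^ i * β ^ (k - i))) := by
  rw [Finset.prod_range_succ, Nat.sub_self, pow_zero, mul_one, mul_comm]
  congr 1
  have : β ^ (k + 1) = ∏ i ∈ Finset.range (k + 1), β := by simp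
  rw [this, ← Finset.prod_mul_distrib]
  refine Finset.prod_congr rfl fun i hi => ?_
  have : k + 1 - i = (k - i) + 1 := by have := Finset.mem_range.mp hi; omega
  rw [this, pow_succ]
  ring

lemma integrable_slice_mul (hN : 0 ≤ N) (hα : 0 ≤ α) (hβ : 0 < β) (hαβ : α ≤ β) (k : ℕ)
    {w : ℝ → ℝ} (hw : Continuous w) : Integrable fun u => slice N α β k u * w u := by
  set B := (k + 1) * N * β ^ k
  rw [← integrableOn_iff_integrable_of_support_subset (s := Icc (-B) B)]
  · obtain ⟨C, hC⟩ := (isCompact_Icc (a := -B) (b := B)).exists_bound_of_continuousOn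
      hw.continuousOn
    refine Measure.integrableOn_of_bounded (M := slice N α β k 0 * C) (by simp)
      ((slice_evenUnimodal hN hα hβ k).measurable.mul hw.measurable).aestronglyMeasurable ?_
    refine (ae_restrict_iff' measurableSet_Icc).mpr (Eventually.of_forall fun u hu => ?_)
    rw [norm_mul, Real.norm_of_nonneg (slice_nonneg hN hα hβ k u)]
    exact mul_le_mul (slice_evenUnimodal hN hα hβ k _ _ (by simp)) (hC u hu) (norm_nonneg _)
      (slice_nonneg hN hα hβ k 0)
  · intro u hu
    by_contra hcon
    refine hu ?_
    simp only
    rw [slice_eq_zero hN hα hβ hαβ k, zero_mul]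
    by_contra h
    exact hcon (abs_le.mp (not_lt.mp h))

/-- Induction on `k`: integrating out the top coefficient replaces `p` by `p + 1`, `c` by `c * β`
and `x` by `x ± c * N * α ^ (k + 1)`, matching `signedSum_succ`. The denominator collects the new
exponents and the weights of the coefficients. -/
lemma integral_slice_mul_truncPow (hN : 0 ≤ N) (hα : 0 < α) (hβ : 0 < β) (hαβ : α ≤ β) (k : ℕ)
    {p c : ℝ} (hp : 0 < p) (hc : 0 < c) (x : ℝ) :
    ∫ u, slice N α β k u * truncPow p (c * u + x) =
      signedSum N α β (p + (k + 1 : ℕ)) k c x / ((∏ i ∈ Finset.range (k + 1), (p + (i + 1))) *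
        (c ^ (k + 1) * ∏ i ∈ Finset.range (k + 1), (α ^ i * β ^ (k - i)))) := by
  induction k generalizing p c x with
  | zero =>
    have h := integral_truncPow_window hp hc x 0 N hN
    rw [signedSum_zero]
    simp only [mul_zero, zero_add, sub_zero] at h
    simp only [slice]
    simp only [mul_comm] at h ⊢
    simp only [h]
    simp
  | succ k ih =>
    have hα' : 0 < α ^ (k + 1) := pow_pos hα _
    have h := integral_mul_slice_succ hN hα hβ hαβ k (w := fun y => truncPow p (c * y + x))
      (σ := fun y => y) ((continuous_truncPow hp.le).comp (by fun_prop)) continuous_id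
      (fun B => by
        refine (Metric.isBounded_Icc (-B) B).subset fun y hy => abs_le.mp hy)
    simp only [mul_comm (slice N α β (k + 1) _)]
    rw [h]
    have h1 : ∀ u, slice N α β k u * ∫ y, truncPow p (c * y + x) *
        (if |y - β * u| ≤ N * α ^ (k + 1) then 1 else 0) =
        (c * (p + 1))⁻¹ *
          (slice N α β k u * truncPow (p + 1) (c * β * u + (x + c * (N * α ^ (k + 1)))) -
          slice N α β k u * truncPow (p + 1) (c * β * u + (x - c * (N * α ^ (k + 1))))) := by
      intro u
      rw [integral_truncPow_window hp hc x _ _ (by positivity), ← mul_assoc c β u]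
      ring
    simp only [h1]
    have hp1 : 0 < p + 1 := by linarith
    rw [integral_const_mul, integral_sub, ih hp1 (by positivity), ih hp1 (by positivity),
      ← sub_div, signedSum_succ, prod_pow_succ, Finset.prod_range_succ' _ (k + 1)]
    · have e1 : p + 1 + ((k + 1 : ℕ) : ℝ) = p + ((k + 1 + 1 : ℕ) : ℝ) := by push_cast; ring
      have e2 : ∏ i ∈ Finset.range (k + 1), (p + 1 + ((i : ℝ) + 1)) =
          ∏ i ∈ Finset.range (k + 1), (p + (((i + 1 : ℕ) : ℝ) + 1)) :=
        Finset.prod_congr rfl fun i _ => by push_cast; ring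
      have e3 : 0 < ∏ i ∈ Finset.range (k + 1), (p + (((i + 1 : ℕ) : ℝ) + 1)) :=
        Finset.prod_pos fun i _ => by positivity
      have e4 : 0 < ∏ i ∈ Finset.range (k + 1), (α ^ i * β ^ (k - i)) :=
        Finset.prod_pos fun i _ => by positivity
      rw [e1, e2]
      field_simp
      push_cast
      ring
    · exact integrable_slice_mul hN hα.le hβ hαβ k
        ((continuous_truncPow hp1.le).comp (by fun_prop))
    · exact integrable_slice_mul hN hα.le hβ hαβ k
        ((continuous_truncPow hp1.le).comp (by fun_prop))

lemma integral_slice_sq (hN : 0 ≤ N) (hα : 0 < α) (hβ : 0 < β) (hαβ : α ≤ β) (k : ℕ) :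
    ∫ y : ℝ, slice N α β (k + 1) (y ^ 2) =
      signedSum N α β (1 / 2 + (k + 1 : ℕ)) (k + 1) 1 0 /
        ((1 / 2) * (∏ i ∈ Finset.range (k + 1), (1 / 2 + (i + 1) : ℝ)) *
          ∏ i ∈ Finset.range (k + 2), (α ^ i * β ^ (k + 1 - i))) := by
  have hα' : 0 < α ^ (k + 1) := pow_pos hα _
  have h := integral_mul_slice_succ hN hα hβ hαβ k (w := fun _ => 1)
    (σ := fun y => y ^ 2) continuous_const (by fun_prop)
    (fun B => by
      refine (Metric.isBounded_Icc (-√B) √B).subset fun y hy => abs_le.mp ?_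
      rw [← Real.sqrt_sq_eq_abs]
      exact Real.sqrt_le_sqrt ((le_abs_self _).trans hy))
  simp only [one_mul] at h
  rw [h]
  have h1 : ∀ u, slice N α β k u * ∫ y : ℝ,
      (if |y ^ 2 - β * u| ≤ N * α ^ (k + 1) then (1 : ℝ) else 0) =
      2 * (slice N α β k u * truncPow (1 / 2) (β * u + N * α ^ (k + 1)) -
        slice N α β k u * truncPow (1 / 2) (β * u + -(N * α ^ (k + 1)))) := by
    intro u
    have := integral_sq_window (β * u) (N * α ^ (k + 1)) (by positivity)
    simp only [one_mul] at this
    rw [this]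
    ring_nf
  simp only [h1]
  have hp : (0 : ℝ) < 1 / 2 := by norm_num
  rw [integral_const_mul, integral_sub,
    integral_slice_mul_truncPow hN hα hβ hαβ k hp hβ,
    integral_slice_mul_truncPow hN hα hβ hαβ k hp hβ,
    ← sub_div, signedSum_succ, prod_pow_succ]
  · have e3 : 0 < ∏ i ∈ Finset.range (k + 1), (1 / 2 + ((i : ℝ) + 1)) :=
      Finset.prod_pos fun i _ => by positivity
    have e4 : 0 < ∏ i ∈ Finset.range (k + 1), (α ^ i * β ^ (k - i)) :=
      Finset.prod_pos fun i _ => by positivity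
    simp only [one_mul, zero_add, zero_sub]
    field_simp
  · exact integrable_slice_mul hN hα.le hβ hαβ k
      ((continuous_truncPow hp.le).comp (by fun_prop))
  · exact integrable_slice_mul hN hα.le hβ hαβ k
      ((continuous_truncPow hp.le).comp (by fun_prop))

end signedSum

/-- By homogeneity `N ^ (13 / 2)` and `β ^ 39` come out, where `39 = 6 * 13 / 2`; the monomials
multiply to `(α β) ^ 21`, and `(1/2)(3/2)⋯(13/2) = 135135 / 128`. -/
lemma integral_slice_eq_phi {N α β : ℝ} (hN : 0 ≤ N) (hα : 0 < α) (hβ : 0 < β) (hαβ : α ≤ β) :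
    ∫ y : ℝ, slice N α β 6 (y ^ 2) =
      128 * N ^ (13 / 2 : ℝ) * (1 / β ^ 3 * phi (α / β)) := by
  rw [integral_slice_sq hN hα hβ hαβ 5, phi, if_neg (by positivity)]
  have ht : |α / β| = α / β := abs_of_pos (by positivity)
  have hS : signedSum N α β (1 / 2 + (5 + 1 : ℕ)) (5 + 1) 1 0 =
      N ^ (13 / 2 : ℝ) * β ^ 39 * ∑ ε : Fin 7 → ℤˣ, (∏ i, ((ε i : ℤ) : ℝ)) *
        (max (∑ i : Fin 7, ((ε i : ℤ) : ℝ) * (α / β) ^ (i : ℕ)) 0) ^ (13 / 2 : ℝ) := by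
    rw [signedSum, Finset.mul_sum]
    refine Finset.sum_congr rfl fun ε _ => ?_
    have e1 : ∑ i : Fin (5 + 1 + 1), ((ε i : ℤ) : ℝ) * α ^ (i : ℕ) * β ^ (5 + 1 - (i : ℕ)) =
        β ^ 6 * ∑ i : Fin 7, ((ε i : ℤ) : ℝ) * (α / β) ^ (i : ℕ) := by
      rw [Finset.mul_sum]
      refine Finset.sum_congr rfl fun i _ => ?_
      have : β ^ 6 = β ^ (5 + 1 - (i : ℕ)) * β ^ (i : ℕ) := by
        rw [← pow_add]; congr 1; have := i.2; omega
      rw [this, div_pow]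
      field_simp
    have e2 : ∀ S : ℝ, truncPow (1 / 2 + (5 + 1 : ℕ)) (0 + 1 * N * (β ^ 6 * S)) =
        N ^ (13 / 2 : ℝ) * β ^ 39 * max S 0 ^ (13 / 2 : ℝ) := by
      intro S
      have : max (0 + 1 * N * (β ^ 6 * S)) 0 = N * (β ^ 6 * max S 0) := by
        rw [mul_max_of_nonneg _ _ (by positivity), mul_max_of_nonneg _ _ hN]
        simp
      rw [truncPow, this, Real.mul_rpow hN (by positivity), Real.mul_rpow (by positivity)
        (le_max_right _ _), ← Real.rpow_natCast β 6, ← Real.rpow_mul hβ.le]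
      norm_num
      rw [mul_assoc]
    rw [e1, e2]
    ring
  rw [hS, ht]
  generalize (∑ ε : Fin 7 → ℤˣ, (∏ i, ((ε i : ℤ) : ℝ)) *
    (max (∑ i : Fin 7, ((ε i : ℤ) : ℝ) * (α / β) ^ (i : ℕ)) 0) ^ (13 / 2 : ℝ)) = S
  simp only [Finset.prod_range_succ, Finset.prod_range_zero]
  push_cast
  norm_num
  field_simp

/-- The signed-sum formula divides by powers of `α`, so `(0 : 1)` is separate: only `f_0` matters,
the others contribute `(2 * N) ^ 6`. This matches `φ 0 = 1`. -/
lemma integral_slice_zero_one {N : ℝ} (hN : 0 ≤ N) :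
    ∫ y : ℝ, slice N 0 1 6 (y ^ 2) = 128 * N ^ (13 / 2 : ℝ) := by
  have h : ∀ k s, slice N 0 1 k s = (2 * N) ^ k * (if |s| ≤ N then 1 else 0) := by
    intro k
    induction k with
    | zero => intro s; simp [slice]
    | succ k ih =>
      intro s
      simp only [slice, ih]
      simp
      ring_nf
  have h2 := integral_sq_window 0 N hN
  simp only [one_mul, sub_zero, truncPow_half, zero_add, zero_sub,
    Real.sqrt_eq_zero_of_nonpos (neg_nonpos.mpr hN)] at h2
  simp only [h]
  rw [integral_const_mul, h2, Real.sqrt_eq_rpow,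
    show (13 / 2 : ℝ) = (6 : ℕ) + 1 / 2 by norm_num, Real.rpow_add' hN (by norm_num),
    Real.rpow_natCast]
  ring

end GenusTwo

/-! ### Singular forms -/

namespace GenusTwo

section jacobian

variable {K : Type*} [CommRing K] [Algebra ℤ K] (f : Fin 7 → ℤ) (v : Fin 3 → K)

lemma aeval_equation : MvPolynomial.aeval v (equation f) =
    v 1 ^ 2 - ∑ j : Fin 7, (f j : K) * v 0 ^ (j : ℕ) * v 2 ^ (6 - (j : ℕ)) := by
  simp [equation]

lemma aeval_pderiv_zero : MvPolynomial.aeval v (MvPolynomial.pderiv 0 (equation f)) =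
    -(f 1 * v 2 ^ 5 + 2 * f 2 * v 0 * v 2 ^ 4 + 3 * f 3 * v 0 ^ 2 * v 2 ^ 3 +
      4 * f 4 * v 0 ^ 3 * v 2 ^ 2 + 5 * f 5 * v 0 ^ 4 * v 2 + 6 * f 6 * v 0 ^ 5) := by
  simp [equation, Fin.sum_univ_succ, Derivation.leibniz_pow, MvPolynomial.pderiv_X,
    Derivation.leibniz]
  ring

lemma aeval_pderiv_one : MvPolynomial.aeval v (MvPolynomial.pderiv 1 (equation f)) =
    2 * v 1 := by
  simp [equation, Fin.sum_univ_succ, Derivation.leibniz_pow, MvPolynomial.pderiv_X,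
    Derivation.leibniz]

lemma aeval_pderiv_two : MvPolynomial.aeval v (MvPolynomial.pderiv 2 (equation f)) =
    -(6 * f 0 * v 2 ^ 5 + 5 * f 1 * v 0 * v 2 ^ 4 + 4 * f 2 * v 0 ^ 2 * v 2 ^ 3 +
      3 * f 3 * v 0 ^ 3 * v 2 ^ 2 + 2 * f 4 * v 0 ^ 4 * v 2 + f 5 * v 0 ^ 5) := by
  simp [equation, Fin.sum_univ_succ, Derivation.leibniz_pow, MvPolynomial.pderiv_X,
    Derivation.leibniz]
  ring

end jacobian

/-- The derivative in `y` is `2 y`, so a singular point has `y = 0` and is a common zero of `F` and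
its two partial derivatives. -/
lemma not_isSmooth_iff (f : Fin 7 → ℤ) : ¬ IsSmooth f ↔ ∃ x z : AlgebraicClosure ℚ,
    (x ≠ 0 ∨ z ≠ 0) ∧ ∑ j : Fin 7, (f j : AlgebraicClosure ℚ) * x ^ (j : ℕ) * z ^ (6 - (j : ℕ)) = 0 ∧
    f 1 * z ^ 5 + 2 * f 2 * x * z ^ 4 + 3 * f 3 * x ^ 2 * z ^ 3 + 4 * f 4 * x ^ 3 * z ^ 2 +
      5 * f 5 * x ^ 4 * z + 6 * f 6 * x ^ 5 = 0 ∧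
    6 * f 0 * z ^ 5 + 5 * f 1 * x * z ^ 4 + 4 * f 2 * x ^ 2 * z ^ 3 + 3 * f 3 * x ^ 3 * z ^ 2 +
      2 * f 4 * x ^ 4 * z + f 5 * x ^ 5 = 0 := by
  rw [IsSmooth]
  push Not
  simp only [Fin.forall_fin_succ (n := 2), Fin.forall_fin_two, Fin.succ_zero_eq_one,
    Fin.succ_one_eq_two, aeval_equation, aeval_pderiv_zero, aeval_pderiv_one, aeval_pderiv_two,
    neg_eq_zero]
  constructor
  · rintro ⟨v, hv, h, h0, h1, h2⟩
    have hv1 : v 1 = 0 := by simpa using h1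
    refine ⟨v 0, v 2, ?_, ?_, h0, h2⟩
    · by_contra hcon
      push Not at hcon
      refine hv (funext fun i => ?_)
      fin_cases i
      · exact hcon.1
      · exact hv1
      · exact hcon.2
    · rw [hv1] at h
      simpa using h
  · rintro ⟨x, z, hxz, h, h0, h2⟩
    refine ⟨![x, 0, z], ?_, ?_, ?_, ?_, ?_⟩
    · rintro hcon
      rcases hxz with hx | hz
      · exact hx (by simpa using congrFun hcon 0)
      · exact hz (by simpa using congrFun hcon 2)
    · simpa using h
    · simpa using h0
    · simp
    · simpa using h2

lemma isSmooth_rev_of (f : Fin 7 → ℤ) (h : IsSmooth fun i => f i.rev) : IsSmooth f := by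
  by_contra hf
  obtain ⟨x, z, hxz, h1, h2, h3⟩ := (not_isSmooth_iff f).mp hf
  refine (not_isSmooth_iff _).mpr ⟨z, x, hxz.symm, ?_, ?_, ?_⟩ h
  · rw [← h1, ← Equiv.sum_comp Fin.revPerm]
    refine Finset.sum_congr rfl fun i _ => ?_
    have : 6 - (6 - (i : ℕ)) = i := by have := i.2; omega
    simp [Fin.val_rev, this]
    ring
  · rw [← h3]
    simp [Fin.rev]
    ring
  · rw [← h2]
    simp [Fin.rev]
    ring

lemma isSmooth_rev_iff (f : Fin 7 → ℤ) : IsSmooth (fun i => f i.rev) ↔ IsSmooth f :=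
  ⟨isSmooth_rev_of f, fun h => isSmooth_rev_of _ (by simpa using h)⟩

lemma isSmooth_fermat : IsSmooth ![1, 0, 0, 0, 0, 0, 1] := by
  by_contra hf
  obtain ⟨x, z, hxz, -, h2, h3⟩ := (not_isSmooth_iff _).mp hf
  have hx : x = 0 := by simpa [Matrix.vecHead, Matrix.vecTail] using h2
  have hz : z = 0 := by simpa [Matrix.vecHead, Matrix.vecTail] using h3
  exact hxz.elim (fun h => h hx) (fun h => h hz)

lemma exists_double_root {f : Fin 7 → ℤ} (hf : ¬ IsSmooth f) (h6 : f 6 ≠ 0) :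
    ∃ ξ : AlgebraicClosure ℚ,
      f 0 + f 1 * ξ + f 2 * ξ ^ 2 + f 3 * ξ ^ 3 + f 4 * ξ ^ 4 + f 5 * ξ ^ 5 + f 6 * ξ ^ 6 = 0 ∧
      f 1 + 2 * f 2 * ξ + 3 * f 3 * ξ ^ 2 + 4 * f 4 * ξ ^ 3 + 5 * f 5 * ξ ^ 4 +
        6 * f 6 * ξ ^ 5 = 0 := by
  obtain ⟨x, z, hxz, h1, h2, -⟩ := (not_isSmooth_iff f).mp hf
  have hz : z ≠ 0 := by
    rintro rfl
    have hx : x = 0 := by simpa [h6] using h2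
    simp [hx] at hxz
  rw [Fin.sum_univ_seven] at h1
  refine ⟨x / z, ?_, ?_⟩
  · have : (z ^ 6)⁻¹ * _ = (z ^ 6)⁻¹ * 0 := congrArg _ h1
    rw [mul_zero] at this
    refine Eq.trans ?_ this
    simp
    field_simp
  · have : (z ^ 5)⁻¹ * _ = (z ^ 5)⁻¹ * 0 := congrArg _ h2
    rw [mul_zero] at this
    refine Eq.trans ?_ this
    field_simp

open Classical in
/-- If all coefficients of `x ^ j` with `2 ≤ j` and the value at `(a, b)` are prescribed, then there
are at most six singular forms of degree `6`. -/
lemma card_singular_of_tail {N : ℕ} {a b : ℤ} (hb : b ≠ 0) (m : ℤ) (f : Fin 7 → ℤ)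
    (h6 : f 6 ≠ 0) :
    ((solutions N a b 6 m).filter fun f' => ¬ IsSmooth f' ∧
      ∀ i : Fin 7, 2 ≤ (i : ℕ) → f' i = f i).card ≤ 6 := by
  have hb' : (b : AlgebraicClosure ℚ) ≠ 0 := by exact_mod_cast hb
  set t : AlgebraicClosure ℚ := a / b with ht
  set c : AlgebraicClosure ℚ := m / b ^ 6 - (f 2 * t ^ 2 + f 3 * t ^ 3 + f 4 * t ^ 4 + f 5 * t ^ 5 +
    f 6 * t ^ 6) with hc
  -- With `t = a / b`, this is `F(ξ) - (ξ - t) F'(ξ) - F(t) + m / b ^ 6`, in which `f 0` and `f 1`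
  -- cancel. A double root `ξ` is one of its at most six roots; then `F'(ξ) = 0` determines `f 1`,
  -- and the value at `(a, b)` determines `f 0`.
  set R : Polynomial (AlgebraicClosure ℚ) :=
    Polynomial.C (-(5 * f 6 : AlgebraicClosure ℚ)) * Polynomial.X ^ 6 +
    Polynomial.C (6 * t * f 6 - 4 * f 5) * Polynomial.X ^ 5 +
    Polynomial.C (5 * t * f 5 - 3 * f 4) * Polynomial.X ^ 4 +
    Polynomial.C (4 * t * f 4 - 2 * f 3) * Polynomial.X ^ 3 +
    Polynomial.C (3 * t * f 3 - f 2) * Polynomial.X ^ 2 +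
    Polynomial.C (2 * t * f 2) * Polynomial.X + Polynomial.C c with hR
  have hdeg : R.natDegree = 6 := by
    have : (-(5 * f 6 : AlgebraicClosure ℚ)) ≠ 0 := by simpa using h6
    rw [hR]
    compute_degree!
  have hR0 : R ≠ 0 := by
    intro h
    rw [h] at hdeg
    simp at hdeg
  set T : Finset (AlgebraicClosure ℚ) := R.roots.toFinset.image fun ξ =>
    -(2 * f 2 * ξ + 3 * f 3 * ξ ^ 2 + 4 * f 4 * ξ ^ 3 + 5 * f 5 * ξ ^ 4 + 6 * f 6 * ξ ^ 5)
  have hT : T.card ≤ 6 := by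
    refine Finset.card_image_le.trans ((Multiset.toFinset_card_le _).trans ?_)
    rw [← hdeg]
    exact R.card_roots'
  have hval : ∀ f' ∈ solutions N a b 6 m, (f' 0 : AlgebraicClosure ℚ) + f' 1 * t + f' 2 * t ^ 2 +
      f' 3 * t ^ 3 + f' 4 * t ^ 4 + f' 5 * t ^ 5 + f' 6 * t ^ 6 = m / b ^ 6 := by
    intro f' hf'
    have h := (Finset.mem_filter.mp hf').2
    rw [Fin.sum_univ_seven] at h
    rw [← h, ht]
    push_cast
    simp
    field_simp
  refine (Finset.card_le_card_of_injOn (fun f' => (f' 1 : AlgebraicClosure ℚ)) ?_ ?_).trans hT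
  · intro f' hf'
    simp only [Finset.coe_filter, Set.mem_ofPred_eq] at hf'
    obtain ⟨hsol, hsing, htail⟩ := hf'
    have e2 := htail 2 (by decide)
    have e3 := htail 3 (by decide)
    have e4 := htail 4 (by decide)
    have e5 := htail 5 (by decide)
    have e6 := htail 6 (by decide)
    obtain ⟨ξ, h1, h2⟩ := exists_double_root hsing (e6 ▸ h6)
    have hv := hval f' hsol
    rw [e2, e3, e4, e5, e6] at h1 h2 hv
    simp only [T, Finset.coe_image, Set.mem_image, Finset.mem_coe, Multiset.mem_toFinset]
    refine ⟨ξ, ?_, by linear_combination -h2⟩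
    rw [Polynomial.mem_roots hR0, Polynomial.IsRoot, hR]
    simp only [Polynomial.eval_add, Polynomial.eval_mul, Polynomial.eval_C, Polynomial.eval_pow,
      Polynomial.eval_X]
    rw [hc]
    linear_combination h1 - (ξ - t) * h2 - hv
  · intro f' hf' f'' hf'' h1
    simp only [Finset.coe_filter, Set.mem_ofPred_eq] at hf' hf''
    have v1 := hval f' hf'.1
    have v2 := hval f'' hf''.1
    have e : ∀ i : Fin 7, 2 ≤ (i : ℕ) → f' i = f'' i := fun i hi =>
      (hf'.2.2 i hi).trans (hf''.2.2 i hi).symm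
    have h1' : f' 1 = f'' 1 := by simpa using h1
    have h0 : f' 0 = f'' 0 := by
      have : (f' 0 : AlgebraicClosure ℚ) = f'' 0 := by
        rw [h1', e 2 (by decide), e 3 (by decide), e 4 (by decide), e 5 (by decide),
          e 6 (by decide), ← v2] at v1
        linear_combination v1
      exact_mod_cast this
    ext i
    rcases Nat.lt_or_ge (i : ℕ) 2 with hi | hi
    · interval_cases h : (i : ℕ)
      · rw [show i = 0 from Fin.ext h, h0]
      · rw [show i = 1 from Fin.ext h, h1']
    · exact e i hi

open Classical in
-- The constant is `6 + 1`. If `f 6 ≠ 0`, the five coefficients of index at least `2` leave six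
-- forms. If `f 6 = 0`, singularity is ignored: the five coefficients `f 1, …, f 5` and the value
-- determine `f 0`.
lemma card_singular_le {N : ℕ} {a b : ℤ} (hab : IsCoprime a b) (hb : b ≠ 0) (m : ℤ) :
    (((solutions N a b 6 m).filter fun f => ¬ IsSmooth f).card : ℝ) ≤
      7 * (1 + 2 * N / |(b : ℝ)|) ^ 5 := by
  set S := (solutions N a b 6 m).filter fun f => ¬ IsSmooth f with hS
  have h1 : ((S.filter fun f => f 6 = 0).card : ℝ) ≤ (1 + 2 * N / |(b : ℝ)|) ^ 5 := by
    have hinj : Set.InjOn (Fin.init : (Fin 7 → ℤ) → Fin 6 → ℤ) (S.filter fun f => f 6 = 0) := by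
      intro f hf g hg hfg
      rw [Finset.coe_filter] at hf hg
      have hf' : f (Fin.last 6) = 0 := hf.2
      have hg' : g (Fin.last 6) = 0 := hg.2
      rw [← Fin.snoc_init_self f, ← Fin.snoc_init_self g, hfg, hf', hg']
    set T : Finset (Fin (5 + 1) → ℤ) := (S.filter fun f => f 6 = 0).image Fin.init with hT
    have hsub : T ⊆ solutions N a b 5 (m / b) := by
      intro g hg
      obtain ⟨f, hf, rfl⟩ := Finset.mem_image.mp hg
      rw [Finset.mem_filter, hS, Finset.mem_filter] at hf
      have hf' : f (Fin.last 6) = 0 := hf.2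
      have := ((mem_solutions_succ (k := 5) hb).mp hf.1.1).2
      rw [hf'] at this
      simpa using this
    have h := card_le_of_tails (N := N) hab hb (d := 1) (D := 1) le_rfl 5 (by norm_num) (m / b)
      T hsub ?_
    · rw [hT, Finset.card_image_of_injOn hinj] at h
      simpa using h
    · intro g hg
      have hval : ∀ g' ∈ T,
          (∀ i : Fin 6, 1 ≤ (i : ℕ) → g' i = g i) → g' = g := by
        intro g' hg' h
        have s1 := (Finset.mem_filter.mp (hsub hg)).2
        have s2 := (Finset.mem_filter.mp (hsub hg')).2
        have s3 := s2.trans s1.symm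
        rw [Fin.sum_univ_succ, Fin.sum_univ_succ (f := fun i : Fin 6 => g i * _ * _)] at s3
        have : ∑ i : Fin 5, g' i.succ * a ^ (i.succ : ℕ) * b ^ (5 - (i.succ : ℕ)) =
            ∑ i : Fin 5, g i.succ * a ^ (i.succ : ℕ) * b ^ (5 - (i.succ : ℕ)) :=
          Finset.sum_congr rfl fun i _ => by rw [h i.succ (by simp)]
        rw [this] at s3
        have h0 : g' 0 = g 0 := by simpa [hb] using s3
        ext i
        refine Fin.cases h0 (fun i => h i.succ (by simp)) i
      rw [Finset.card_le_one]
      intro x hx y hy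
      rw [Finset.mem_filter] at hx hy
      rw [hval x hx.1 hx.2, hval y hy.1 hy.2]
  have h2 : ((S.filter fun f => ¬ f 6 = 0).card : ℝ) ≤ 6 * (1 + 2 * N / |(b : ℝ)|) ^ 5 := by
    refine card_le_of_tails hab hb (d := 2) (D := 6) (by norm_num) 6 (by norm_num) m _
      (fun f hf => ?_) fun f hf => ?_
    · simp only [hS, Finset.mem_filter] at hf
      exact hf.1.1
    · rw [Finset.mem_filter] at hf
      refine le_trans (Finset.card_le_card fun f' hf' => ?_)
        (card_singular_of_tail (N := N) (a := a) hb m f hf.2)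
      simp only [hS, Finset.mem_filter] at hf' ⊢
      exact ⟨hf'.1.1.1, hf'.1.1.2, hf'.2⟩
  have h3 := Finset.card_filter_add_card_filter_not (s := S) (fun f => f 6 = 0)
  rw [← h3]
  push_cast
  linarith

end GenusTwo

/-! ### Square values at a single point `(a : b)` -/

namespace GenusTwo

open MeasureTheory

section pointwise

variable {a b : ℤ}

lemma ne_zero_of_abs_le (hab : IsCoprime a b) (hle : |a| ≤ |b|) : b ≠ 0 := by
  rintro rfl
  have : a = 0 := by simpa using hle
  subst this
  exact not_isCoprime_zero_zero hab

lemma integral_slice_of_coprime (hab : IsCoprime a b) (hle : |a| ≤ |b|) {N : ℝ} (hN : 0 ≤ N) :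
    ∫ y : ℝ, slice N |(a : ℝ)| |(b : ℝ)| 6 (y ^ 2) =
      128 * N ^ (13 / 2 : ℝ) * (1 / |(b : ℝ)| ^ 3 * phi (|(a : ℝ)| / |(b : ℝ)|)) := by
  have hb := ne_zero_of_abs_le hab hle
  rcases eq_or_ne a 0 with rfl | ha
  · have h1 : |b| = 1 := by
      rw [isCoprime_zero_left] at hab
      exact Int.isUnit_iff_abs_eq.mp hab
    have h1' : |(b : ℝ)| = 1 := by exact_mod_cast h1
    rw [h1', Int.cast_zero, abs_zero, integral_slice_zero_one hN]
    simp [phi]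
  · exact integral_slice_eq_phi hN (abs_pos.mpr (by exact_mod_cast ha))
      (abs_pos.mpr (by exact_mod_cast hb)) (by exact_mod_cast hle)

/-- Sign and size are invisible in the alternating sum, but clear from the integral with `N = 1`:
the integrand lies between `0` and `(2 / |b|) ^ 6` and vanishes for `|y| > 3 |b|³`, because `7 <
3²`. -/
lemma gamma_aux (hab : IsCoprime a b) (hle : |a| ≤ |b|) :
    0 ≤ 1 / |(b : ℝ)| ^ 3 * phi (|(a : ℝ)| / |(b : ℝ)|) ∧
      1 / |(b : ℝ)| ^ 3 * phi (|(a : ℝ)| / |(b : ℝ)|) ≤ 3 / |(b : ℝ)| ^ 3 := by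
  have hb : 0 < |(b : ℝ)| := abs_pos.mpr (by exact_mod_cast ne_zero_of_abs_le hab hle)
  have hle' : |(a : ℝ)| ≤ |(b : ℝ)| := by exact_mod_cast hle
  have h := integral_slice_of_coprime hab hle zero_le_one
  rw [Real.one_rpow, mul_one] at h
  have h0 := slice_nonneg zero_le_one (abs_nonneg (a : ℝ)) hb 6
  set R := 3 * |(b : ℝ)| ^ 3 with hR
  have hsupp : Function.support (fun y : ℝ => slice 1 |(a : ℝ)| |(b : ℝ)| 6 (y ^ 2)) ⊆
      Set.Icc (-R) R := by
    intro y hy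
    by_contra hcon
    refine hy (slice_eq_zero zero_le_one (abs_nonneg _) hb hle' 6 ?_)
    have h1 : R < |y| := by
      by_contra h
      exact hcon (abs_le.mp (not_lt.mp h))
    have h2 : R ^ 2 < y ^ 2 := by
      rw [← sq_abs y]
      exact pow_lt_pow_left₀ h1 (by positivity) two_ne_zero
    rw [abs_of_nonneg (sq_nonneg y)]
    have h3 : 0 < |(b : ℝ)| ^ 6 := by positivity
    push_cast
    nlinarith
  have hint : ∫ y : ℝ, slice 1 |(a : ℝ)| |(b : ℝ)| 6 (y ^ 2) ≤ (2 / |(b : ℝ)|) ^ 6 * (2 * R) := by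
    rw [← setIntegral_eq_integral_of_forall_compl_eq_zero (s := Set.Icc (-R) R)
      fun y hy => by_contra fun hcon => hy (hsupp hcon)]
    have := norm_setIntegral_le_of_norm_le_const (μ := volume) (s := Set.Icc (-R) R)
      (f := fun y : ℝ => slice 1 |(a : ℝ)| |(b : ℝ)| 6 (y ^ 2)) (C := (2 / |(b : ℝ)|) ^ 6)
      measure_Icc_lt_top fun y _ => by
        rw [Real.norm_of_nonneg (h0 _)]
        simpa using slice_le zero_le_one (abs_nonneg (a : ℝ)) hb 6 (y ^ 2)
    rw [Real.volume_real_Icc_of_le (by linarith [(by positivity : 0 ≤ R)])] at this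
    refine (le_abs_self _).trans (this.trans (le_of_eq ?_))
    ring
  constructor
  · have : 0 ≤ ∫ y : ℝ, slice 1 |(a : ℝ)| |(b : ℝ)| 6 (y ^ 2) := integral_nonneg fun y => h0 _
    linarith
  · rw [h] at hint
    have : (2 / |(b : ℝ)|) ^ 6 * (2 * R) = 128 * (3 / |(b : ℝ)| ^ 3) := by
      rw [hR]; field_simp; norm_num
    linarith

/-- The curves in `curves N` whose defining form takes the value `m` at `(a, b)`. -/
noncomputable def curvesWithValue (N : ℕ) (a b m : ℤ) : Finset (Fin 7 → ℤ) :=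
  (curves N).filter fun f => ∑ i : Fin 7, f i * a ^ (i : ℕ) * b ^ (6 - (i : ℕ)) = m

lemma card_curvesWithValue_swap (N : ℕ) (a b m : ℤ) :
    (curvesWithValue N a b m).card = (curvesWithValue N b a m).card := by
  have key : ∀ a b : ℤ, ∀ f ∈ curvesWithValue N a b m,
      (fun i : Fin 7 => f i.rev) ∈ curvesWithValue N b a m := by
    intro a b f hf
    simp only [curvesWithValue, curves, Finset.mem_filter, Fintype.mem_piFinset] at hf ⊢
    refine ⟨⟨fun i => hf.1.1 _, (isSmooth_rev_iff f).mpr hf.1.2⟩, ?_⟩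
    rw [← hf.2, ← Equiv.sum_comp Fin.revPerm]
    refine Finset.sum_congr rfl fun i _ => ?_
    have : 6 - (6 - (i : ℕ)) = i := by have := i.2; omega
    simp [Fin.val_rev, this]
    ring
  refine Finset.card_bij' (fun f _ => fun i => f i.rev) (fun f _ => fun i => f i.rev)
    (key a b) (key b a) ?_ ?_
  · intro f _; simp
  · intro f _; simp

lemma abs_card_curvesWithValue_sub_slice_le (N : ℕ) (hab : IsCoprime a b) (hb : b ≠ 0) (m : ℤ) :
    |((curvesWithValue N a b m).card : ℝ) - slice N |(a : ℝ)| |(b : ℝ)| 6 m| ≤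
      13 * (1 + 2 * N / |(b : ℝ)|) ^ 5 := by
  classical
  -- The constant `13` is `6` from the density approximation plus `7` from the singular forms.
  have h1 := abs_card_solutions_sub_slice_le (N := N) hab hb 5 m
  have h2 := card_singular_le (N := N) hab hb m
  have h3 := Finset.card_filter_add_card_filter_not (s := solutions N a b 6 m) IsSmooth
  have h4 : curvesWithValue N a b m = (solutions N a b 6 m).filter IsSmooth := by
    ext f
    simp only [curvesWithValue, curves, solutions, Finset.mem_filter]
    tauto
  rw [← h4] at h3
  have h5 : ((curvesWithValue N a b m).card : ℝ) + (((solutions N a b 6 m).filter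
      fun f => ¬ IsSmooth f).card : ℝ) = (solutions N a b 6 m).card := by exact_mod_cast h3
  have h6 : (0 : ℝ) ≤ (((solutions N a b 6 m).filter fun f => ¬ IsSmooth f).card : ℝ) :=
    Nat.cast_nonneg _
  rw [abs_le] at h1 ⊢
  push_cast at h1
  constructor <;> linarith

/-- The largest integer whose square does not exceed `7 * N * h ^ 6`. -/
def ordinateBound (N h : ℕ) : ℕ := Nat.sqrt (7 * N * h ^ 6)

/-- The error term at a point of height `h`. -/
noncomputable def pointError (N h : ℝ) : ℝ := N ^ 6 / h ^ 3 + √N * N ^ 5 / h ^ 2 + √N * h ^ 3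

lemma two_mul_ordinateBound_add_one_le {N h : ℕ} (hN : 1 ≤ N) (hh : 1 ≤ h) :
    (2 * ordinateBound N h + 1 : ℝ) ≤ 7 * (√N * h ^ 3) := by
  have hN' : (1 : ℝ) ≤ N := by exact_mod_cast hN
  have hh' : (1 : ℝ) ≤ h := by exact_mod_cast hh
  have h1 : (ordinateBound N h : ℝ) ≤ 3 * (√N * h ^ 3) := by
    have h2 : (ordinateBound N h : ℝ) ^ 2 ≤ 7 * N * h ^ 6 := by
      have := Nat.sqrt_le' (7 * N * h ^ 6)
      exact_mod_cast this
    have h3 : (3 * (√N * h ^ 3)) ^ 2 = 9 * N * (h : ℝ) ^ 6 := by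
      have := Real.sq_sqrt (by linarith : (0 : ℝ) ≤ N)
      calc _ = 9 * √N ^ 2 * (h : ℝ) ^ 6 := by ring
        _ = _ := by rw [this]
    refine le_of_sq_le_sq ?_ (by positivity)
    rw [h3]
    have : (0 : ℝ) ≤ N * h ^ 6 := by positivity
    linarith
  have h2 : 1 ≤ √(N : ℝ) * (h : ℝ) ^ 3 :=
    one_le_mul_of_one_le_of_one_le (Real.one_le_sqrt.mpr hN') (one_le_pow₀ hh')
  linarith

/-- Two errors add up: counts are replaced by densities for each of the `2 Y + 1` values of `y`, and
the sum of the even unimodal function `y ↦ slice (y ^ 2)` is replaced by its integral. -/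
lemma abs_sum_card_sub_le_of_le {N : ℕ} (hN : 1 ≤ N) (hab : IsCoprime a b) (hle : |a| ≤ |b|) :
    |∑ y ∈ Finset.Icc (-(ordinateBound N b.natAbs : ℤ)) (ordinateBound N b.natAbs),
      ((curvesWithValue N a b (y ^ 2)).card : ℝ) -
        128 * (N : ℝ) ^ (13 / 2 : ℝ) * (1 / |(b : ℝ)| ^ 3 * phi (|(a : ℝ)| / |(b : ℝ)|))| ≤
      50000 * pointError N |(b : ℝ)| := by
  have hb := ne_zero_of_abs_le hab hle
  have hN0 : (0 : ℝ) ≤ N := Nat.cast_nonneg N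
  have hb1 : 1 ≤ b.natAbs := Int.natAbs_pos.mpr hb
  have hbR : |(b : ℝ)| = (b.natAbs : ℝ) := by rw [Nat.cast_natAbs]; simp
  have hb0 : 0 < |(b : ℝ)| := abs_pos.mpr (by exact_mod_cast hb)
  have hle' : |(a : ℝ)| ≤ |(b : ℝ)| := by exact_mod_cast hle
  set Y := ordinateBound N b.natAbs with hY
  have hE := slice_evenUnimodal hN0 (abs_nonneg (a : ℝ)) hb0 6
  have hE2 : EvenUnimodal fun y : ℝ => slice N |(a : ℝ)| |(b : ℝ)| 6 (y ^ 2) := by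
    intro x y hxy
    refine hE _ _ ?_
    rw [abs_pow, abs_pow]
    gcongr
  have hzero : ∀ y : ℝ, 7 * N * |(b : ℝ)| ^ 6 < y ^ 2 →
      slice N |(a : ℝ)| |(b : ℝ)| 6 (y ^ 2) = 0 := by
    intro y hy
    refine slice_eq_zero hN0 (abs_nonneg _) hb0 hle' 6 ?_
    rw [abs_of_nonneg (sq_nonneg y)]
    push_cast
    linarith
  have h1 := abs_sum_sub_integral_le (ψ := fun y : ℝ => slice N |(a : ℝ)| |(b : ℝ)| 6 (y ^ 2))
    (M := (2 * N / |(b : ℝ)|) ^ 6) (R := √(7 * N * |(b : ℝ)| ^ 6))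
    (fun y => slice_nonneg hN0 (abs_nonneg _) hb0 6 _)
    (fun y => slice_le hN0 (abs_nonneg _) hb0 6 _) (fun t _ => hE2.convex t)
    (fun y hy => hzero y (by
      rw [← Real.sqrt_sq_eq_abs y] at hy
      exact (Real.sqrt_lt_sqrt_iff (by positivity)).mp hy))
    (Finset.Icc (-(Y : ℤ)) Y) (fun y hy => hzero y (by
      have h2 : (Y : ℤ) < |y| := by
        by_contra h
        exact hy (Finset.mem_Icc.mpr (abs_le.mp (not_lt.mp h)))
      have h3 : Y < y.natAbs := by
        rw [Int.abs_eq_natAbs] at h2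
        exact_mod_cast h2
      have h4 := Nat.sqrt_lt'.mp h3
      have h5 : ((7 * N * b.natAbs ^ 6 : ℕ) : ℝ) < ((y.natAbs ^ 2 : ℕ) : ℝ) := by exact_mod_cast h4
      push_cast at h5
      rw [hbR, ← sq_abs (y : ℝ)]
      convert h5 using 2
      rw [Nat.cast_natAbs]; simp))
  rw [integral_slice_of_coprime hab hle hN0] at h1
  have h2 : |∑ y ∈ Finset.Icc (-(Y : ℤ)) Y, ((curvesWithValue N a b (y ^ 2)).card : ℝ) -
      ∑ y ∈ Finset.Icc (-(Y : ℤ)) Y, slice N |(a : ℝ)| |(b : ℝ)| 6 ((y : ℝ) ^ 2)| ≤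
      (2 * Y + 1) * (13 * (1 + 2 * N / |(b : ℝ)|) ^ 5) := by
    rw [← Finset.sum_sub_distrib]
    refine (Finset.abs_sum_le_sum_abs _ _).trans ((Finset.sum_le_card_nsmul _ _
      (13 * (1 + 2 * N / |(b : ℝ)|) ^ 5) fun y _ => ?_).trans_eq ?_)
    · have := abs_card_curvesWithValue_sub_slice_le N hab hb (y ^ 2)
      push_cast at this
      exact this
    · rw [Int.card_Icc, nsmul_eq_mul]
      congr 1
      have : ((Y : ℤ) + 1 - -(Y : ℤ)).toNat = 2 * Y + 1 := by omega
      rw [this]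
      push_cast
      ring
  have h3 := abs_sub_le _ _ _ |>.trans (add_le_add h2 h1)
  refine h3.trans ?_
  have h4 := two_mul_ordinateBound_add_one_le hN hb1
  rw [← hY, ← hbR] at h4
  have hh1 : 1 ≤ |(b : ℝ)| := by rw [hbR]; exact_mod_cast hb1
  have h5 := add_pow_le zero_le_one (by positivity : 0 ≤ 2 * N / |(b : ℝ)|) 5
  rw [one_pow] at h5
  generalize |(b : ℝ)| = h at *
  have h6 : (2 * Y + 1) * (13 * (1 + 2 * N / h) ^ 5) ≤
      7 * (√N * h ^ 3) * (13 * (2 ^ (5 - 1) * (1 + (2 * N / h) ^ 5))) := by gcongr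
  have h7 : 7 * (√N * h ^ 3) * (13 * (2 ^ (5 - 1) * (1 + (2 * N / h) ^ 5))) =
      1456 * (√N * h ^ 3) + 46592 * (√N * N ^ 5 / h ^ 2) := by
    field_simp
    ring
  -- Since `h ≥ 1`, decay `h⁻³` may replace `h⁻⁶`; it suffices for summation over `O(h)` points of
  -- height `h`.
  have h8 : (2 * N / h) ^ 6 ≤ 64 * (N ^ 6 / h ^ 3) := by
    rw [div_pow, mul_pow, mul_div_assoc]
    norm_num
    gcongr
    norm_num
  rw [pointError]
  have p1 : 0 ≤ √N * h ^ 3 := by positivity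
  have p2 : 0 ≤ √N * N ^ 5 / h ^ 2 := by positivity
  have p3 : 0 ≤ N ^ 6 / h ^ 3 := by positivity
  linarith

end pointwise

end GenusTwo

/-! ### Rational points over a given `x`-coordinate -/

namespace GenusTwo

lemma isCoprime_coprimeRep (P : OnePoint ℚ) : IsCoprime (coprimeRep P).1 (coprimeRep P).2 := by
  induction P using OnePoint.rec with
  | infty => exact isCoprime_one_left
  | coe q => exact Int.isCoprime_iff_gcd_eq_one.mpr q.reduced

lemma coprimeRep_injective : Function.Injective coprimeRep := by
  intro P Q h
  induction P using OnePoint.rec with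
  | infty =>
    induction Q using OnePoint.rec with
    | infty => rfl
    | coe q =>
      have : (0 : ℤ) = q.den := congrArg Prod.snd h
      exact absurd this.symm (by exact_mod_cast q.den_nz)
  | coe p =>
    induction Q using OnePoint.rec with
    | infty =>
      have : (p.den : ℤ) = 0 := congrArg Prod.snd h
      exact absurd this (by exact_mod_cast p.den_nz)
    | coe q =>
      have h1 : p.num = q.num := congrArg Prod.fst h
      have h2 : (p.den : ℤ) = q.den := congrArg Prod.snd h
      rw [Rat.ext h1 (by exact_mod_cast h2)]

lemma one_le_height (P : OnePoint ℚ) : 1 ≤ height P := by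
  by_contra h
  have h0 : height P ≤ 0 := by omega
  have h1 : |(coprimeRep P).1| ≤ 0 := (le_max_left _ _).trans h0
  have h2 : |(coprimeRep P).2| ≤ 0 := (le_max_right _ _).trans h0
  have := isCoprime_coprimeRep P
  rw [abs_nonpos_iff.mp h1, abs_nonpos_iff.mp h2] at this
  exact not_isCoprime_zero_zero this

lemma natAbs_height_cast (P : OnePoint ℚ) : ((height P).natAbs : ℝ) = height P := by
  rw [Nat.cast_natAbs, abs_of_nonneg (by have := one_le_height P; omega)]

/-- The number of pairs of a curve in `curves N` and a rational point on it whose `x`-coordinate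
is `P`. -/
noncomputable def fibreCount (N : ℕ) (P : OnePoint ℚ) : ℕ :=
  ∑ y ∈ Finset.Icc (-(ordinateBound N (height P).natAbs : ℤ)) (ordinateBound N (height P).natAbs),
    (curvesWithValue N (coprimeRep P).1 (coprimeRep P).2 (y ^ 2)).card

lemma abs_fibreCount_sub_le {N : ℕ} (hN : 1 ≤ N) (P : OnePoint ℚ) :
    |(fibreCount N P : ℝ) - 128 * (N : ℝ) ^ (13 / 2 : ℝ) * gamma P| ≤
      50000 * pointError N (height P) := by
  have hab := isCoprime_coprimeRep P
  rw [fibreCount, gamma, height]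
  generalize (coprimeRep P).1 = a at *
  generalize (coprimeRep P).2 = b at *
  push_cast
  rcases le_total |a| |b| with h | h
  · have h' : |(a : ℝ)| ≤ |(b : ℝ)| := by exact_mod_cast h
    rw [max_eq_right h, max_eq_right h', min_eq_left h', Int.natAbs_abs]
    exact abs_sum_card_sub_le_of_le hN hab h
  · have h' : |(b : ℝ)| ≤ |(a : ℝ)| := by exact_mod_cast h
    rw [max_eq_left h, max_eq_left h', min_eq_right h', Int.natAbs_abs]
    simp only [card_curvesWithValue_swap N a b]
    exact abs_sum_card_sub_le_of_le hN hab.symm h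

lemma gamma_nonneg_and_le (P : OnePoint ℚ) :
    0 ≤ gamma P ∧ gamma P ≤ 3 / (height P : ℝ) ^ 3 := by
  have hab := isCoprime_coprimeRep P
  rw [gamma, height]
  generalize (coprimeRep P).1 = a at *
  generalize (coprimeRep P).2 = b at *
  push_cast
  rcases le_total |a| |b| with h | h
  · have h' : |(a : ℝ)| ≤ |(b : ℝ)| := by exact_mod_cast h
    rw [max_eq_right h', min_eq_left h']
    exact gamma_aux hab h
  · have h' : |(b : ℝ)| ≤ |(a : ℝ)| := by exact_mod_cast h
    rw [max_eq_left h', min_eq_right h']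
    exact gamma_aux hab.symm h

/-- The point `(a : y : b)`, where `P = (a : b)` with coprime integers `a`, `b`. -/
noncomputable def pointOver (P : OnePoint ℚ) (y : ℤ) : WeightedPlane :=
  Quotient.mk weightedSetoid ⟨![((coprimeRep P).1 : ℚ), y, (coprimeRep P).2], by
    intro h
    have h1 : (coprimeRep P).1 = 0 := by simpa using congrFun h 0
    have h2 : (coprimeRep P).2 = 0 := by simpa using congrFun h 2
    have := isCoprime_coprimeRep P
    rw [h1, h2] at this
    exact not_isCoprime_zero_zero this⟩

lemma xCoord_pointOver (P : OnePoint ℚ) (y : ℤ) : xCoord (pointOver P y) = P := by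
  simp only [xCoord, pointOver, Quotient.lift_mk]
  induction P using OnePoint.rec with
  | infty => simp [coprimeRep]
  | coe q => simp [coprimeRep, Rat.num_div_den]

/-- The coordinates `(a, b)` are fixed and not both zero, so the scaling factor is `1`; in
particular `y` and `-y` give distinct points unless `y = 0`. -/
lemma pointOver_injective (P : OnePoint ℚ) : Function.Injective (pointOver P) := by
  intro y y' h
  obtain ⟨c, hc, h0, h1, h2⟩ := Quotient.exact h
  simp only [Matrix.cons_val_zero, Matrix.cons_val_one, Matrix.cons_val] at h0 h1 h2
  have hc1 : c = 1 := by
    by_contra hne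
    have hz : ∀ x : ℤ, (x : ℚ) = c * x → x = 0 := by
      intro x hx
      have : (c - 1) * x = 0 := by linear_combination -hx
      rcases mul_eq_zero.mp this with h | h
      · exact absurd (sub_eq_zero.mp h) hne
      · exact_mod_cast h
    have := isCoprime_coprimeRep P
    rw [hz _ h0, hz _ h2] at this
    exact not_isCoprime_zero_zero this
  rw [hc1] at h1
  have : (y' : ℚ) = y := by simpa using h1
  exact_mod_cast this.symm

lemma exists_int_of_sq_eq {r : ℚ} {m : ℤ} (h : r ^ 2 = m) : ∃ y : ℤ, (y : ℚ) = r := by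
  have : IsIntegral ℤ (r ^ 2) := by rw [h]; exact isIntegral_algebraMap (R := ℤ) (x := m)
  obtain ⟨y, hy⟩ := IsIntegrallyClosed.exists_algebraMap_eq_of_isIntegral_pow two_pos this
  exact ⟨y, by simpa using hy⟩

lemma onCurve_pointOver {f : Fin 7 → ℤ} {P : OnePoint ℚ} {y : ℤ}
    (h : ∑ i : Fin 7, f i * (coprimeRep P).1 ^ (i : ℕ) * (coprimeRep P).2 ^ (6 - (i : ℕ)) = y ^ 2) :
    OnCurve f (pointOver P y) := by
  refine ⟨_, rfl, ?_⟩
  rw [aeval_equation, sub_eq_zero]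
  simp only [Matrix.cons_val_zero, Matrix.cons_val_one, Matrix.cons_val]
  exact_mod_cast h.symm

/-- Scale to coprime `(a, b)`: the new `y` is a rational number whose square is the integer `F(a,
b)`, hence an integer. -/
lemma exists_eq_pointOver {f : Fin 7 → ℤ} {Q : WeightedPlane} (h : OnCurve f Q) :
    ∃ y : ℤ, Q = pointOver (xCoord Q) y ∧
      ∑ i : Fin 7, f i * (coprimeRep (xCoord Q)).1 ^ (i : ℕ) *
        (coprimeRep (xCoord Q)).2 ^ (6 - (i : ℕ)) = y ^ 2 := by
  obtain ⟨v, rfl, hv⟩ := h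
  rw [aeval_equation, sub_eq_zero] at hv
  have hlam : ∃ c : ℚ, c ≠ 0 ∧
      v.1 0 = c * (coprimeRep (xCoord (Quotient.mk weightedSetoid v))).1 ∧
      v.1 2 = c * (coprimeRep (xCoord (Quotient.mk weightedSetoid v))).2 := by
    simp only [xCoord, Quotient.lift_mk]
    by_cases h2 : v.1 2 = 0
    · rw [if_pos h2]
      refine ⟨v.1 0, ?_, by simp [coprimeRep], by simp [coprimeRep, h2]⟩
      -- If `x = z = 0`, the equation would give `y = 0` too.
      intro h0
      have h1 : v.1 1 = 0 := by
        rw [h0, h2] at hv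
        have : v.1 1 ^ 2 = 0 := by
          rw [hv]
          refine Finset.sum_eq_zero fun i _ => ?_
          by_cases hi : (i : ℕ) = 0
          · simp [hi]
          · simp [hi]
        simpa using this
      refine v.2 (funext fun i => ?_)
      fin_cases i
      · exact h0
      · exact h1
      · exact h2
    · rw [if_neg h2]
      set q : ℚ := v.1 0 / v.1 2 with hq
      have hden : (q.den : ℚ) ≠ 0 := by exact_mod_cast q.den_nz
      refine ⟨v.1 2 / q.den, div_ne_zero h2 hden, ?_, ?_⟩
      · have : (q.num : ℚ) = q * q.den := (Rat.mul_den_eq_num q).symm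
        simp only [coprimeRep, OnePoint.elim_some]
        rw [this, hq]
        field_simp
      · simp only [coprimeRep, OnePoint.elim_some]
        push_cast
        field_simp
  obtain ⟨c, hc, h0, h2⟩ := hlam
  generalize hP : xCoord (Quotient.mk weightedSetoid v) = P at *
  have hsq : (v.1 1 / c ^ 3) ^ 2 = ((∑ i : Fin 7, f i * (coprimeRep P).1 ^ (i : ℕ) *
      (coprimeRep P).2 ^ (6 - (i : ℕ)) : ℤ) : ℚ) := by
    rw [div_pow, hv, h0, h2, div_eq_iff (by positivity)]
    push_cast
    rw [Finset.sum_mul]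
    refine Finset.sum_congr rfl fun i _ => ?_
    have : (c ^ 3) ^ 2 = c ^ (i : ℕ) * c ^ (6 - (i : ℕ)) := by
      rw [← pow_add, ← pow_mul]
      congr 1
      have := i.2
      omega
    rw [this, mul_pow, mul_pow]
    ring
  obtain ⟨y, hy⟩ := exists_int_of_sq_eq hsq
  refine ⟨y, ?_, ?_⟩
  · symm
    refine Quotient.sound ⟨c, hc, ?_, ?_, ?_⟩
    · simpa using h0
    · simp only [Matrix.cons_val_one, Matrix.cons_val_zero]
      rw [hy]
      field_simp
    · simpa using h2
  · rw [← hy] at hsq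
    exact_mod_cast hsq.symm

lemma abs_le_ordinateBound {N : ℕ} {f : Fin 7 → ℤ} (hf : ∀ i, |f i| ≤ N) (P : OnePoint ℚ) {y : ℤ}
    (h : ∑ i : Fin 7, f i * (coprimeRep P).1 ^ (i : ℕ) * (coprimeRep P).2 ^ (6 - (i : ℕ)) = y ^ 2) :
    y ∈ Finset.Icc (-(ordinateBound N (height P).natAbs : ℤ))
      (ordinateBound N (height P).natAbs) := by
  have h0 : (0 : ℤ) ≤ height P := by have := one_le_height P; omega
  have hle : y ^ 2 ≤ 7 * N * height P ^ 6 := by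
    rw [← h]
    refine (le_abs_self _).trans ((Finset.abs_sum_le_sum_abs _ _).trans
      ((Finset.sum_le_card_nsmul _ _ (N * height P ^ 6) fun i _ => ?_).trans_eq ?_))
    · rw [abs_mul, abs_mul, abs_pow, abs_pow, mul_assoc]
      have e : height P ^ 6 = height P ^ (i : ℕ) * height P ^ (6 - (i : ℕ)) := by
        rw [← pow_add]
        congr 1
        have := i.2
        omega
      rw [e]
      have h1 : |(coprimeRep P).1| ≤ height P := le_max_left _ _
      have h2 : |(coprimeRep P).2| ≤ height P := le_max_right _ _
      have := hf i
      gcongr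
    · simp
      ring
  have h1 : y.natAbs ≤ ordinateBound N (height P).natAbs := by
    refine Nat.le_sqrt'.mpr ?_
    zify
    rw [sq_abs, abs_of_nonneg h0]
    exact hle
  rw [Finset.mem_Icc, ← abs_le, Int.abs_eq_natAbs]
  exact_mod_cast h1

lemma finite_height_le (H : ℝ) : {P : OnePoint ℚ | (height P : ℝ) ≤ H}.Finite := by
  refine Set.Finite.of_finite_image (f := coprimeRep) ?_ coprimeRep_injective.injOn
  refine ((Finset.Icc (-⌊H⌋) ⌊H⌋) ×ˢ (Finset.Icc (-⌊H⌋) ⌊H⌋)).finite_toSet.subset ?_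
  rintro _ ⟨P, hP, rfl⟩
  have h : height P ≤ ⌊H⌋ := Int.le_floor.mpr hP
  simp only [Finset.coe_product, Set.mem_prod, Finset.mem_coe, Finset.mem_Icc, ← abs_le]
  exact ⟨(le_max_left _ _).trans h, (le_max_right _ _).trans h⟩

/-- The points of `ℙ¹(ℚ)` of height at most `H`. -/
noncomputable def heightFinset (H : ℝ) : Finset (OnePoint ℚ) := (finite_height_le H).toFinset

lemma mem_heightFinset {H : ℝ} {P : OnePoint ℚ} : P ∈ heightFinset H ↔ (height P : ℝ) ≤ H := by
  simp [heightFinset]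

lemma gammaSum_eq (H : ℝ) : gammaSum H = ∑ P ∈ heightFinset H, gamma P := by
  rw [gammaSum, finsum_mem_eq_finite_toFinset_sum _ (finite_height_le H)]
  rfl

lemma ncard_points {N : ℕ} {f : Fin 7 → ℤ} (hf : ∀ i, |f i| ≤ N) (H : ℝ) :
    Set.ncard {Q : WeightedPlane | OnCurve f Q ∧ (height (xCoord Q) : ℝ) ≤ H} =
      ∑ P ∈ heightFinset H, ((Finset.Icc (-(ordinateBound N (height P).natAbs : ℤ))
        (ordinateBound N (height P).natAbs)).filter fun y => ∑ i : Fin 7,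
          f i * (coprimeRep P).1 ^ (i : ℕ) * (coprimeRep P).2 ^ (6 - (i : ℕ)) = y ^ 2).card := by
  classical
  set T : OnePoint ℚ → Finset ℤ := fun P => (Finset.Icc (-(ordinateBound N (height P).natAbs : ℤ))
    (ordinateBound N (height P).natAbs)).filter fun y => ∑ i : Fin 7,
      f i * (coprimeRep P).1 ^ (i : ℕ) * (coprimeRep P).2 ^ (6 - (i : ℕ)) = y ^ 2 with hT
  have hset : {Q : WeightedPlane | OnCurve f Q ∧ (height (xCoord Q) : ℝ) ≤ H} =
      ((heightFinset H).biUnion fun P => (T P).image (pointOver P) : Finset WeightedPlane) := by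
    ext Q
    simp only [Set.mem_ofPred_eq, Finset.coe_biUnion, Finset.mem_coe, Set.mem_iUnion,
      Finset.mem_image, mem_heightFinset, exists_prop, hT, Finset.mem_filter]
    constructor
    · rintro ⟨hQ, hH⟩
      obtain ⟨y, hy, hsum⟩ := exists_eq_pointOver hQ
      exact ⟨xCoord Q, hH, y, ⟨abs_le_ordinateBound hf _ hsum, hsum⟩, hy.symm⟩
    · rintro ⟨P, hP, y, ⟨_, hy⟩, rfl⟩
      rw [xCoord_pointOver]
      exact ⟨onCurve_pointOver hy, hP⟩
  rw [hset, Set.ncard_coe_finset, Finset.card_biUnion]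
  · exact Finset.sum_congr rfl fun P _ => Finset.card_image_of_injective _ (pointOver_injective P)
  · intro P _ P' _ hne
    rw [Function.onFun, Finset.disjoint_left]
    intro Q hQ hQ'
    obtain ⟨y, _, rfl⟩ := Finset.mem_image.mp hQ
    obtain ⟨y', _, hy'⟩ := Finset.mem_image.mp hQ'
    refine hne ?_
    rw [← xCoord_pointOver P y, ← hy', xCoord_pointOver]

lemma averagePoints_eq (N : ℕ) (H : ℝ) : averagePoints N H =
    (∑ P ∈ heightFinset H, (fibreCount N P : ℝ)) / (curves N).card := by
  rw [averagePoints]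
  congr 1
  norm_cast
  have h1 : ∀ f ∈ curves N, Set.ncard {Q : WeightedPlane | OnCurve f Q ∧
      (height (xCoord Q) : ℝ) ≤ H} = _ := fun f hf => ncard_points (N := N) (fun i => by
    simp only [curves, Finset.mem_filter, Fintype.mem_piFinset, Finset.mem_Icc] at hf
    exact abs_le.mpr (hf.1 i)) H
  rw [Finset.sum_congr rfl h1, Finset.sum_comm]
  refine Finset.sum_congr rfl fun P _ => ?_
  simp only [fibreCount, curvesWithValue, Finset.card_filter]
  rw [Finset.sum_comm]

end GenusTwo

/-! ### Summation over heights -/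

namespace GenusTwo

lemma card_filter_height_le (s : Finset (OnePoint ℚ)) {h : ℕ} (hh : 1 ≤ h) :
    (s.filter fun P => (height P).natAbs = h).card ≤ 12 * h := by
  classical
  -- One coordinate is `± h`, the other lies in `[-h, h]`, which gives at most `2 * 2 * (2 * h + 1)
  -- ≤ 12 * h` pairs.
  rw [← Finset.card_image_of_injective _ coprimeRep_injective]
  have hsub : (s.filter fun P => (height P).natAbs = h).image coprimeRep ⊆
      ({(h : ℤ), -(h : ℤ)} : Finset ℤ) ×ˢ Finset.Icc (-(h : ℤ)) h ∪
        Finset.Icc (-(h : ℤ)) h ×ˢ ({(h : ℤ), -(h : ℤ)} : Finset ℤ) := by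
    intro p hp
    obtain ⟨P, hP, rfl⟩ := Finset.mem_image.mp hp
    have h1 := (Finset.mem_filter.mp hP).2
    have h2 : height P = h := by have := one_le_height P; omega
    have h3 : |(coprimeRep P).1| ≤ h := h2 ▸ le_max_left _ _
    have h4 : |(coprimeRep P).2| ≤ h := h2 ▸ le_max_right _ _
    have h5 : |(coprimeRep P).1| = h ∨ |(coprimeRep P).2| = h := by
      rw [← h2, height]
      exact (max_choice _ _).imp Eq.symm Eq.symm
    simp only [Finset.mem_union, Finset.mem_product, Finset.mem_insert, Finset.mem_singleton,
      Finset.mem_Icc, ← abs_le, ← abs_eq (Nat.cast_nonneg h : (0 : ℤ) ≤ h)]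
    tauto
  refine (Finset.card_le_card hsub).trans ((Finset.card_union_le _ _).trans ?_)
  rw [Finset.card_product, Finset.card_product, Int.card_Icc]
  have h2 : ({(h : ℤ), -(h : ℤ)} : Finset ℤ).card ≤ 2 := Finset.card_le_two
  have h3 : ((h : ℤ) + 1 - -(h : ℤ)).toNat = 2 * h + 1 := by omega
  rw [h3]
  nlinarith

lemma sum_height_le (H : ℝ) {e : ℝ → ℝ} (he : ∀ h, 0 ≤ h → 0 ≤ e h) :
    ∑ P ∈ heightFinset H, e (height P) ≤ ∑ h ∈ Finset.Icc 1 ⌊H⌋₊, 12 * (h : ℝ) * e h := by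
  rw [← Finset.sum_fiberwise_of_maps_to (s := heightFinset H) (t := Finset.Icc 1 ⌊H⌋₊)
    (g := fun P => (height P).natAbs)]
  · refine Finset.sum_le_sum fun h hh => ?_
    have h1 : ∀ P ∈ (heightFinset H).filter fun P => (height P).natAbs = h,
        e (height P) = e h := by
      intro P hP
      rw [← natAbs_height_cast, (Finset.mem_filter.mp hP).2]
    rw [Finset.sum_congr rfl h1, Finset.sum_const, nsmul_eq_mul]
    refine mul_le_mul_of_nonneg_right ?_ (he h (Nat.cast_nonneg h))
    exact_mod_cast card_filter_height_le _ (Finset.mem_Icc.mp hh).1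
  · intro P hP
    have h1 := one_le_height P
    have h2 := mem_heightFinset.mp hP
    rw [Finset.mem_Icc]
    refine ⟨by omega, Nat.le_floor ?_⟩
    rwa [natAbs_height_cast]

lemma sum_inv_sq_le (n : ℕ) : ∑ h ∈ Finset.Icc 1 n, 1 / (h : ℝ) ^ 2 ≤ 2 := by
  rcases Nat.eq_zero_or_pos n with rfl | hn
  · simp
  have : ∑ h ∈ Finset.Icc 1 n, 1 / (h : ℝ) ^ 2 ≤ 2 - 1 / (n : ℝ) := by
    induction n, hn using Nat.le_induction with
    | base => norm_num
    | succ n hn ih =>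
      rw [Finset.sum_Icc_succ_top (by omega)]
      have hn0 : (0 : ℝ) < n := by exact_mod_cast hn
      have : 1 / ((n + 1 : ℕ) : ℝ) ^ 2 ≤ 1 / n - 1 / ((n + 1 : ℕ) : ℝ) := by
        push_cast
        rw [div_sub_div _ _ hn0.ne' (by positivity), div_le_div_iff₀ (by positivity) (by positivity)]
        nlinarith
      linarith
  have h2 : (0 : ℝ) ≤ 1 / n := by positivity
  linarith

lemma sum_inv_le {H : ℝ} (hH : 1 ≤ H) :
    ∑ h ∈ Finset.Icc 1 ⌊H⌋₊, 1 / (h : ℝ) ≤ 1 + Real.log H := by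
  have h1 := harmonic_le_one_add_log ⌊H⌋₊
  rw [harmonic_eq_sum_Icc] at h1
  push_cast at h1
  have hpos : (0 : ℝ) < ⌊H⌋₊ := by exact_mod_cast Nat.floor_pos.mpr hH
  have h2 := Real.log_le_log hpos (Nat.floor_le (by linarith : 0 ≤ H))
  simp only [one_div]
  linarith

lemma sum_pow_four_le {H : ℝ} (hH : 1 ≤ H) :
    ∑ h ∈ Finset.Icc 1 ⌊H⌋₊, (h : ℝ) ^ 4 ≤ H ^ 5 := by
  have hfl : (⌊H⌋₊ : ℝ) ≤ H := Nat.floor_le (by linarith)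
  refine (Finset.sum_le_card_nsmul _ _ (H ^ 4) fun h hh => ?_).trans ?_
  · have : (h : ℝ) ≤ ⌊H⌋₊ := by exact_mod_cast (Finset.mem_Icc.mp hh).2
    gcongr
    linarith
  · rw [Nat.card_Icc, nsmul_eq_mul, Nat.add_sub_cancel, pow_succ' H 4]
    gcongr

lemma gammaSum_nonneg (H : ℝ) : 0 ≤ gammaSum H := by
  rw [gammaSum_eq]
  exact Finset.sum_nonneg fun P _ => (gamma_nonneg_and_le P).1

/-- Uniform boundedness is what lets the number of curves be replaced by `128 N ^ 7`, and what makes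
the main term vanish in the limit. `72` is `12 * 3 * 2`. -/
lemma gammaSum_le (H : ℝ) : gammaSum H ≤ 72 := by
  rw [gammaSum_eq]
  refine (Finset.sum_le_sum fun P _ => (gamma_nonneg_and_le P).2).trans ?_
  refine (sum_height_le H (e := fun h => 3 / h ^ 3) fun h hh => by positivity).trans ?_
  have : ∀ h ∈ Finset.Icc 1 ⌊H⌋₊, 12 * (h : ℝ) * (3 / (h : ℝ) ^ 3) = 36 * (1 / (h : ℝ) ^ 2) := by
    intro h hh
    have : (0 : ℝ) < h := by exact_mod_cast (Finset.mem_Icc.mp hh).1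
    field_simp
    norm_num
  rw [Finset.sum_congr rfl this, ← Finset.mul_sum]
  linarith [sum_inv_sq_le ⌊H⌋₊]

lemma sum_pointError_le {N : ℝ} (hN : 0 ≤ N) {H : ℝ} (hH : 1 ≤ H) :
    ∑ P ∈ heightFinset H, pointError N (height P) ≤
      12 * (2 * N ^ 6 + √N * N ^ 5 * (1 + Real.log H) + √N * H ^ 5) := by
  refine (sum_height_le H fun h hh => by rw [pointError]; positivity).trans ?_
  have : ∀ h ∈ Finset.Icc 1 ⌊H⌋₊, 12 * (h : ℝ) * pointError N h =
      12 * (N ^ 6 * (1 / (h : ℝ) ^ 2) + √N * N ^ 5 * (1 / (h : ℝ)) + √N * (h : ℝ) ^ 4) := by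
    intro h hh
    have : (0 : ℝ) < h := by exact_mod_cast (Finset.mem_Icc.mp hh).1
    rw [pointError]
    field_simp
  rw [Finset.sum_congr rfl this, ← Finset.mul_sum, Finset.sum_add_distrib, Finset.sum_add_distrib,
    ← Finset.mul_sum, ← Finset.mul_sum, ← Finset.mul_sum, mul_comm 2 (N ^ 6)]
  have h1 := sum_inv_sq_le ⌊H⌋₊
  have h2 := sum_inv_le hH
  have h3 := sum_pow_four_le hH
  gcongr

/-! ### The number of curves -/

lemma curves_card_pos {N : ℕ} (hN : 1 ≤ N) : 1 ≤ (curves N).card := by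
  refine Finset.card_pos.mpr ⟨![1, 0, 0, 0, 0, 0, 1], ?_⟩
  simp only [curves, Finset.mem_filter, Fintype.mem_piFinset, Finset.mem_Icc]
  refine ⟨fun i => ?_, isSmooth_fermat⟩
  fin_cases i <;> simp <;> omega

/-- The value at `(0, 1)` is `f 0`, so the pointwise bound for singular forms at that point, summed
over `f 0`, gives `7 * (2 * N + 1) ^ 6 ≤ 7 * 729 * N ^ 6`. -/
lemma abs_card_curves_sub_le {N : ℕ} (hN : 1 ≤ N) :
    |((curves N).card : ℝ) - 128 * (N : ℝ) ^ 7| ≤ 5103 * (N : ℝ) ^ 6 := by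
  classical
  set B := Fintype.piFinset fun _ : Fin 7 => Finset.Icc (-(N : ℤ)) N with hB
  have hBcard : B.card = (2 * N + 1) ^ 7 := by
    rw [hB, Fintype.card_piFinset]
    simp only [Int.card_Icc, Finset.prod_const, Finset.card_univ, Fintype.card_fin]
    congr 1
    omega
  have hsplit := Finset.card_filter_add_card_filter_not (s := B) IsSmooth
  have hc : curves N = B.filter IsSmooth := by
    ext f
    simp only [curves, hB, Finset.mem_filter]
  rw [← hc, hBcard] at hsplit
  have hsing : ((B.filter fun f => ¬ IsSmooth f).card : ℝ) ≤ 7 * (2 * N + 1) ^ 6 := by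
    rw [Finset.card_eq_sum_card_fiberwise (f := fun f => f 0)
      (t := Finset.Icc (-(N : ℤ)) N) fun f hf => by
        rw [Finset.mem_coe, Finset.mem_filter, hB, Fintype.mem_piFinset] at hf
        exact hf.1 0]
    push_cast
    refine (Finset.sum_le_card_nsmul _ _ (7 * (2 * (N : ℝ) + 1) ^ 5) fun m _ => ?_).trans_eq ?_
    · have h := card_singular_le (N := N) (a := 0) (b := 1) isCoprime_one_right one_ne_zero m
      rw [Int.cast_one, abs_one, div_one, add_comm 1] at h
      refine le_trans ?_ h
      norm_cast
      refine Finset.card_le_card fun f hf => ?_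
      simp only [Finset.mem_filter, hB, solutions] at hf ⊢
      refine ⟨⟨hf.1.1, ?_⟩, hf.1.2⟩
      rw [Fin.sum_univ_succ]
      simpa using hf.2
    · rw [Int.card_Icc, nsmul_eq_mul]
      have : ((N : ℤ) + 1 - -(N : ℤ)).toNat = 2 * N + 1 := by omega
      rw [this]
      push_cast
      ring
  have hsplit' : ((curves N).card : ℝ) + ((B.filter fun f => ¬ IsSmooth f).card : ℝ) =
      (2 * N + 1) ^ 7 := by exact_mod_cast hsplit
  have hN1 : (1 : ℝ) ≤ N := by exact_mod_cast hN
  have h0 : (0 : ℝ) ≤ ((B.filter fun f => ¬ IsSmooth f).card : ℝ) := Nat.cast_nonneg _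
  have h6 : (2 * (N : ℝ) + 1) ^ 6 ≤ 729 * (N : ℝ) ^ 6 := by
    calc (2 * (N : ℝ) + 1) ^ 6 ≤ (3 * N) ^ 6 := by gcongr; linarith
      _ = _ := by ring
  have hlow : 128 * (N : ℝ) ^ 7 ≤ (2 * N + 1) ^ 7 := by
    calc 128 * (N : ℝ) ^ 7 = (2 * N) ^ 7 := by ring
      _ ≤ _ := by gcongr; linarith
  have hup : (2 * (N : ℝ) + 1) ^ 7 - 128 * (N : ℝ) ^ 7 ≤ 7 * (2 * N + 1) ^ 6 := by
    have hn : (0 : ℝ) ≤ N := by linarith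
    have : 0 ≤ 7 * (2 * (N : ℝ) + 1) ^ 6 - ((2 * (N : ℝ) + 1) ^ 7 - 128 * (N : ℝ) ^ 7) := by
      ring_nf
      positivity
    linarith
  rw [abs_le]
  constructor <;> linarith

/-- For small `N` the asymptotic lower bound may be negative; there the existence of one smooth
curve suffices. -/
lemma pow_le_card_curves {N : ℕ} (hN : 1 ≤ N) :
    (N : ℝ) ^ 7 ≤ 80 ^ 7 * (curves N).card := by
  have h1 := (abs_le.mp (abs_card_curves_sub_le hN)).1
  have h2 : (1 : ℝ) ≤ (curves N).card := by exact_mod_cast curves_card_pos hN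
  rcases le_total (N : ℝ) 80 with h | h
  · calc (N : ℝ) ^ 7 ≤ 80 ^ 7 := by gcongr
      _ ≤ _ := by linarith
  · have : 80 * (N : ℝ) ^ 6 ≤ (N : ℝ) ^ 7 := by
      rw [pow_succ' (N : ℝ) 6]; gcongr
    linarith

/-! ### The asymptotic formula and its limits -/

/-- The error term of the asymptotic formula for the average number of points. -/
noncomputable def averageError (N H : ℝ) : ℝ :=
  N ^ (-1 : ℝ) + Real.log H * N ^ (-(3 / 2) : ℝ) + H ^ 5 * N ^ (-(13 / 2) : ℝ)

lemma rpow_half_odd {x : ℝ} (hx : 0 ≤ x) (n : ℕ) : x ^ ((n : ℝ) + 1 / 2) = x ^ n * √x := by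
  rw [Real.rpow_add_of_nonneg hx (by positivity) (by norm_num), Real.rpow_natCast,
    Real.sqrt_eq_rpow]

lemma pow_seven_mul_averageError {N : ℝ} (hN : 0 < N) (H : ℝ) :
    N ^ 7 * averageError N H = N ^ 6 + Real.log H * (√N * N ^ 5) + √N * H ^ 5 := by
  have e1 : N ^ 7 * N ^ (-1 : ℝ) = N ^ 6 := by
    rw [Real.rpow_neg_one]; field_simp
  have e2 : N ^ 7 * N ^ (-(3 / 2) : ℝ) = √N * N ^ 5 := by
    rw [← Real.rpow_natCast N 7, ← Real.rpow_add hN, mul_comm, ← rpow_half_odd hN.le]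
    norm_num
  have e3 : N ^ 7 * N ^ (-(13 / 2) : ℝ) = √N := by
    rw [← Real.rpow_natCast N 7, ← Real.rpow_add hN, Real.sqrt_eq_rpow]
    norm_num
  rw [averageError, ← e1, ← e2]
  calc _ = N ^ 7 * N ^ (-1 : ℝ) + Real.log H * (N ^ 7 * N ^ (-(3 / 2) : ℝ)) +
        (N ^ 7 * N ^ (-(13 / 2) : ℝ)) * H ^ 5 := by ring
    _ = _ := by rw [e3]

lemma averageError_nonneg {N H : ℝ} (hN : 0 ≤ N) (hH : 1 ≤ H) : 0 ≤ averageError N H := by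
  have := Real.log_nonneg hH
  rw [averageError]
  positivity

lemma exists_abs_averagePoints_sub_le : ∃ C : ℝ, 0 ≤ C ∧ ∀ N : ℕ, 1 ≤ N → ∀ H : ℝ, 1 ≤ H →
    |averagePoints N H - gammaSum H / √N| ≤ C * averageError N H := by
  refine ⟨80 ^ 7 * 3000000, by norm_num, fun N hN H hH => ?_⟩
  have hN1 : (1 : ℝ) ≤ N := by exact_mod_cast hN
  have hN0 : (0 : ℝ) < N := by linarith
  have hK : (0 : ℝ) < (curves N).card := by
    exact_mod_cast (curves_card_pos hN : 0 < (curves N).card)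
  have hs : 0 < √(N : ℝ) := Real.sqrt_pos.mpr hN0
  have hs1 : 1 ≤ √(N : ℝ) := Real.one_le_sqrt.mpr hN1
  have hsN : √(N : ℝ) ≤ N := by
    nlinarith [Real.sq_sqrt hN0.le]
  have hlog := Real.log_nonneg hH
  set A : ℝ := ∑ P ∈ heightFinset H, (fibreCount N P : ℝ) with hA
  have hA1 : |A - 128 * (N : ℝ) ^ (13 / 2 : ℝ) * gammaSum H| ≤
      50000 * (12 * (2 * (N : ℝ) ^ 6 + √N * (N : ℝ) ^ 5 * (1 + Real.log H) + √N * H ^ 5)) := by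
    rw [hA, gammaSum_eq, Finset.mul_sum, ← Finset.sum_sub_distrib]
    refine (Finset.abs_sum_le_sum_abs _ _).trans
      ((Finset.sum_le_sum fun P _ => abs_fibreCount_sub_le hN P).trans ?_)
    rw [← Finset.mul_sum]
    exact mul_le_mul_of_nonneg_left (sum_pointError_le hN0.le hH) (by norm_num)
  -- The cost of replacing `128 N ^ 7` by the true number of curves in the main term.
  have hA2 : |128 * (N : ℝ) ^ (13 / 2 : ℝ) * gammaSum H -
      gammaSum H / √N * (curves N).card| ≤ 72 * 5103 * (N : ℝ) ^ 6 := by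
    have e : (N : ℝ) ^ (13 / 2 : ℝ) = (N : ℝ) ^ 7 / √N := by
      rw [show (13 / 2 : ℝ) = (6 : ℕ) + 1 / 2 by norm_num, rpow_half_odd hN0.le,
        eq_div_iff hs.ne', mul_assoc, Real.mul_self_sqrt hN0.le, ← pow_succ]
    have e2 : 128 * (N : ℝ) ^ (13 / 2 : ℝ) * gammaSum H - gammaSum H / √N * (curves N).card =
        gammaSum H / √N * -((curves N).card - 128 * (N : ℝ) ^ 7) := by
      rw [e]; ring
    have h1 : gammaSum H / √N ≤ 72 :=
      (div_le_self (gammaSum_nonneg H) hs1).trans (gammaSum_le H)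
    have h2 : 0 ≤ gammaSum H / √N := div_nonneg (gammaSum_nonneg H) hs.le
    rw [e2, abs_mul, abs_neg, abs_of_nonneg h2, mul_assoc]
    exact mul_le_mul h1 (abs_card_curves_sub_le hN) (abs_nonneg _) (by norm_num)
  have hdiff : averagePoints N H - gammaSum H / √N =
      (A - gammaSum H / √N * (curves N).card) / (curves N).card := by
    rw [averagePoints_eq, ← hA]
    field_simp
  rw [hdiff, abs_div, abs_of_pos hK, div_le_iff₀ hK]
  have hE := averageError_nonneg hN0.le hH
  have hE7 := pow_seven_mul_averageError hN0 H
  have hK7 := mul_le_mul_of_nonneg_right (pow_le_card_curves hN) hE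
  rw [hE7] at hK7
  have h3 := abs_sub_le A (128 * (N : ℝ) ^ (13 / 2 : ℝ) * gammaSum H)
    (gammaSum H / √N * (curves N).card)
  have h4 : √(N : ℝ) * (N : ℝ) ^ 5 ≤ (N : ℝ) ^ 6 := by
    rw [pow_succ' (N : ℝ) 5]; gcongr
  have p1 : 0 ≤ Real.log H * (√(N : ℝ) * (N : ℝ) ^ 5) := by positivity
  have p2 : 0 ≤ √(N : ℝ) * H ^ 5 := by positivity
  have p3 : 0 ≤ (N : ℝ) ^ 6 := by positivity
  have h5 : √(N : ℝ) * (N : ℝ) ^ 5 * (1 + Real.log H) =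
    √(N : ℝ) * (N : ℝ) ^ 5 + Real.log H * (√(N : ℝ) * (N : ℝ) ^ 5) := by ring
  rw [h5] at hA1
  have h6 : 80 ^ 7 * 3000000 * averageError N H * (curves N).card =
    3000000 * (80 ^ 7 * (curves N).card * averageError N H) := by ring
  rw [h6]
  linarith

lemma heightFinset_eq_empty {H : ℝ} (hH : H < 1) : heightFinset H = ∅ := by
  refine Finset.eq_empty_of_forall_notMem fun P hP => ?_
  have h1 := mem_heightFinset.mp hP
  have h2 : (1 : ℝ) ≤ height P := by exact_mod_cast one_le_height P
  linarith

/-- The error term is small if `H` grows like a power of `N`. -/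
lemma averageError_le {A κ N H : ℝ} (hκ : κ ≤ 2) (hN : 1 ≤ N) (hH : 1 ≤ H)
    (hHN : H ≤ A * N ^ κ) :
    averageError N H ≤ (1 + 4 * A ^ (1 / 4 : ℝ)) * N ^ (-1 : ℝ) + A ^ 5 * N ^ (5 * κ - 13 / 2) := by
  have hN0 : 0 < N := by linarith
  have hNκ : 0 < N ^ κ := Real.rpow_pos_of_pos hN0 κ
  have hA : 0 < A := by
    by_contra h
    nlinarith [mul_nonneg (neg_nonneg.mpr (not_lt.mp h)) hNκ.le]
  -- From `log H ≤ 4 H ^ (1 / 4)` and `κ ≤ 2`: half a power of `N` is just what reduces the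
  -- logarithmic term to `N ^ (-1)`.
  have h1 : Real.log H ≤ 4 * A ^ (1 / 4 : ℝ) * N ^ (1 / 2 : ℝ) := by
    have h2 := Real.log_le_rpow_div (by linarith : 0 ≤ H) (by norm_num : (0 : ℝ) < 1 / 4)
    have h3 : H ^ (1 / 4 : ℝ) ≤ (A * N ^ (2 : ℝ)) ^ (1 / 4 : ℝ) := by
      refine Real.rpow_le_rpow (by linarith) (hHN.trans ?_) (by norm_num)
      exact mul_le_mul_of_nonneg_left (Real.rpow_le_rpow_of_exponent_le hN hκ) hA.le
    rw [Real.mul_rpow hA.le (by positivity), ← Real.rpow_mul hN0.le] at h3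
    norm_num at h2 h3 ⊢
    linarith
  have h2 : Real.log H * N ^ (-(3 / 2) : ℝ) ≤ 4 * A ^ (1 / 4 : ℝ) * N ^ (-1 : ℝ) := by
    refine (mul_le_mul_of_nonneg_right h1 (by positivity)).trans_eq ?_
    rw [mul_assoc, ← Real.rpow_add hN0]
    norm_num
  have h3 : H ^ 5 * N ^ (-(13 / 2) : ℝ) ≤ A ^ 5 * N ^ (5 * κ - 13 / 2) := by
    have h4 : H ^ 5 ≤ (A * N ^ κ) ^ 5 := by gcongr
    refine (mul_le_mul_of_nonneg_right h4 (by positivity)).trans_eq ?_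
    rw [mul_pow, ← Real.rpow_natCast (N ^ κ) 5, ← Real.rpow_mul hN0.le, mul_assoc,
      ← Real.rpow_add hN0]
    congr 2
    push_cast
    ring
  rw [averageError]
  linarith

lemma tendsto_natCast_rpow_neg {y : ℝ} (hy : y < 0) :
    Tendsto (fun N : ℕ => (N : ℝ) ^ y) atTop (𝓝 0) := by
  have := (tendsto_rpow_neg_atTop (neg_pos.mpr hy)).comp tendsto_natCast_atTop_atTop
  simpa [Function.comp_def] using this

lemma averagePoints_nonneg (N : ℕ) (H : ℝ) : 0 ≤ averagePoints N H := by
  rw [averagePoints]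
  positivity

end GenusTwo

theorem mainTheorem2 :
    (∃ C : ℝ, ∀ N : ℕ, 1 ≤ N → ∀ H : ℝ, 1 ≤ H →
      |GenusTwo.averagePoints N H - GenusTwo.gammaSum H / Real.sqrt N| ≤
        C * ((N : ℝ) ^ (-1 : ℝ) + Real.log H * (N : ℝ) ^ (-(3 / 2) : ℝ)
          + H ^ 5 * (N : ℝ) ^ (-(13 / 2) : ℝ))) ∧
    (∀ (ε : ℝ) (H : ℕ → ℝ), 0 < ε →
      H =O[atTop] (fun N : ℕ => (N : ℝ) ^ (6 / 5 - ε : ℝ)) →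
      Tendsto (fun N : ℕ =>
        Real.sqrt N * GenusTwo.averagePoints N (H N) - GenusTwo.gammaSum (H N)) atTop (𝓝 0)) ∧
    (∀ (ε : ℝ) (H : ℕ → ℝ), 0 < ε →
      H =O[atTop] (fun N : ℕ => (N : ℝ) ^ (13 / 10 - ε : ℝ)) →
      Tendsto (fun N : ℕ => GenusTwo.averagePoints N (H N)) atTop (𝓝 0)) := by
  obtain ⟨C, hC0, hC⟩ := GenusTwo.exists_abs_averagePoints_sub_le
  have key : ∀ (κ A : ℝ) (N : ℕ) (H : ℝ), 0 < A → κ ≤ 2 → 1 ≤ N → |H| ≤ A * (N : ℝ) ^ κ →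
      |GenusTwo.averagePoints N H - GenusTwo.gammaSum H / √N| ≤
        C * ((1 + 4 * A ^ (1 / 4 : ℝ)) * (N : ℝ) ^ (-1 : ℝ) +
          A ^ 5 * (N : ℝ) ^ (5 * κ - 13 / 2)) := by
    intro κ A N H hA hκ hN hHN
    -- The growth condition permits `H < 1`; then no point qualifies and both quantities are zero.
    rcases lt_or_ge H 1 with hH | hH
    · rw [GenusTwo.averagePoints_eq, GenusTwo.gammaSum_eq, GenusTwo.heightFinset_eq_empty hH]
      simp only [Finset.sum_empty, zero_div, sub_zero, abs_zero]
      positivity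
    · exact (hC N hN H hH).trans (mul_le_mul_of_nonneg_left
        (GenusTwo.averageError_le hκ (by exact_mod_cast hN) hH ((le_abs_self H).trans hHN)) hC0)
  have bound : ∀ (κ : ℝ) (H : ℕ → ℝ), κ ≤ 2 → H =O[atTop] (fun N : ℕ => (N : ℝ) ^ κ) →
      ∃ A > 0, ∀ᶠ N : ℕ in atTop, 1 ≤ N ∧
        |GenusTwo.averagePoints N (H N) - GenusTwo.gammaSum (H N) / √N| ≤
          C * ((1 + 4 * A ^ (1 / 4 : ℝ)) * (N : ℝ) ^ (-1 : ℝ) +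
            A ^ 5 * (N : ℝ) ^ (5 * κ - 13 / 2)) := by
    intro κ H hκ hH
    obtain ⟨A, hA, hAH⟩ := hH.exists_pos
    refine ⟨A, hA, ?_⟩
    filter_upwards [hAH.bound, eventually_ge_atTop 1] with N h hN
    refine ⟨hN, key κ A N (H N) hA hκ hN ?_⟩
    rwa [Real.norm_eq_abs, Real.norm_of_nonneg (by positivity)] at h
  refine ⟨⟨C, hC⟩, fun ε H hε hH => ?_, fun ε H hε hH => ?_⟩
  · obtain ⟨A, hA, hev⟩ := bound (6 / 5 - ε) H (by linarith) hH
    have hlim : Tendsto (fun N : ℕ => C * ((1 + 4 * A ^ (1 / 4 : ℝ)) * (N : ℝ) ^ (-(1 / 2) : ℝ) +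
        A ^ 5 * (N : ℝ) ^ (-(5 * ε)))) atTop (𝓝 0) := by
      have := (((GenusTwo.tendsto_natCast_rpow_neg (y := -(1 / 2)) (by norm_num)).const_mul
        (1 + 4 * A ^ (1 / 4 : ℝ))).add ((GenusTwo.tendsto_natCast_rpow_neg (y := -(5 * ε))
          (by linarith)).const_mul (A ^ 5))).const_mul C
      simpa using this
    refine squeeze_zero_norm' ?_ hlim
    filter_upwards [hev] with N hN
    obtain ⟨hN1, h⟩ := hN
    have hN0 : (0 : ℝ) < N := by exact_mod_cast hN1
    have hs : 0 < √(N : ℝ) := Real.sqrt_pos.mpr hN0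
    have e : √(N : ℝ) * GenusTwo.averagePoints N (H N) - GenusTwo.gammaSum (H N) =
        √N * (GenusTwo.averagePoints N (H N) - GenusTwo.gammaSum (H N) / √N) := by
      field_simp
    rw [Real.norm_eq_abs, e, abs_mul, abs_of_pos hs]
    refine (mul_le_mul_of_nonneg_left h hs.le).trans_eq ?_
    have e1 : √(N : ℝ) * (N : ℝ) ^ (-1 : ℝ) = (N : ℝ) ^ (-(1 / 2) : ℝ) := by
      rw [Real.sqrt_eq_rpow, ← Real.rpow_add hN0]; norm_num
    -- The exponent `6 / 5` is critical: `1 / 2 + 5 * (6 / 5) - 13 / 2 = 0`. Without the factor `√N`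
    -- the critical exponent is `13 / 10`.
    have e2 : √(N : ℝ) * (N : ℝ) ^ (5 * (6 / 5 - ε) - 13 / 2) = (N : ℝ) ^ (-(5 * ε)) := by
      rw [Real.sqrt_eq_rpow, ← Real.rpow_add hN0]; congr 1; ring
    rw [← e1, ← e2]
    ring
  · obtain ⟨A, hA, hev⟩ := bound (13 / 10 - ε) H (by linarith) hH
    have hlim : Tendsto (fun N : ℕ => C * ((1 + 4 * A ^ (1 / 4 : ℝ)) * (N : ℝ) ^ (-1 : ℝ) +
        A ^ 5 * (N : ℝ) ^ (5 * (13 / 10 - ε) - 13 / 2)) + 72 * (N : ℝ) ^ (-(1 / 2) : ℝ))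
        atTop (𝓝 0) := by
      have := ((((GenusTwo.tendsto_natCast_rpow_neg (y := -1) (by norm_num)).const_mul
        (1 + 4 * A ^ (1 / 4 : ℝ))).add ((GenusTwo.tendsto_natCast_rpow_neg
          (y := 5 * (13 / 10 - ε) - 13 / 2) (by linarith)).const_mul (A ^ 5))).const_mul C).add
        ((GenusTwo.tendsto_natCast_rpow_neg (y := -(1 / 2)) (by norm_num)).const_mul 72)
      simpa using this
    refine squeeze_zero_norm' ?_ hlim
    filter_upwards [hev] with N hN
    obtain ⟨hN1, h⟩ := hN
    have hN0 : (0 : ℝ) < N := by exact_mod_cast hN1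
    have h1 : GenusTwo.gammaSum (H N) / √N ≤ 72 * (N : ℝ) ^ (-(1 / 2) : ℝ) := by
      rw [Real.rpow_neg hN0.le, ← Real.sqrt_eq_rpow, div_eq_mul_inv]
      exact mul_le_mul_of_nonneg_right (GenusTwo.gammaSum_le _) (by positivity)
    rw [Real.norm_of_nonneg (GenusTwo.averagePoints_nonneg _ _)]
    linarith [(abs_le.mp h).2]
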